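/- Definitions. A one-manifold is a Hausdorff, second countable space in which every point has an open neighbourhood homeomorphic to an open subset of $[0,\infty)$ (so boundary is allowed, and connectedness is not required). For an oriented one-manifold $M$, let $\mathrm{Homeo}^+(M)$ be the group of its orientation preserving homeomorphisms (if $M$ is connected, this group does not depend on the orientation). Let $a,b\in\mathrm{Homeo}^+(\mathbb R)$ be given by $a(x)=x+1$ and $b(x)=x$ for $x\le 0$, $b(x)=2x$ for $0<x<1$, $b(x)=x+1$ for $x\ge 1$; Thompson's group is $F=\langle a,b\rangle$. For $n\ge 2$, an $n$-chain of intervals is a family $J_1,\dots,J_n$ of nonempty, possibly unbounded, open intervals of $\mathbb R$ such that $J_i\cap J_k=\varnothing$ if $|i-k|>1$ and, for $1\le i<n$, $J_i\cap J_{i+1}$ is a nonempty proper subinterval of $J_i$ and of $J_{i+1}$. A subgroup $G\le\mathrm{Homeo}^+(\mathbb R)$ is an $n$-chain group if there are an $n$-chain of intervals $J_1,\dots,J_n$ with $\inf J_i<\inf J_{i+1}$ for $1\le i<n$ and $f_1,\dots,f_n\in\mathrm{Homeo}^+(\mathbb R)$ such that $\{x\in\mathbb R: f_i(x)\ne x\}=J_i$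 and $f_i(t)\ge t$ for all $i$ and all $t\in\mathbb R$, $G=\langle f_1,\dots,f_n\rangle$, and $\langle f_i,f_{i+1}\rangle\cong F$ for $1\le i<n$. Statement. For every nonempty oriented one-manifold $M$, there exist uncountably many isomorphism types of countable simple subgroups of $\mathrm{Homeo}^+(M)$. These simple groups can be realized as the commutator subgroups of $3$-chain groups. That is, there is an uncountable set $\mathcal S$ of pairwise non-isomorphic countable simple subgroups of $\mathrm{Homeo}^+(M)$ such that every $S\in\mathcal S$ is the commutator subgroup $[L,L]$ of a subgroup $L\le\mathrm{Homeo}^+(M)$ that is isomorphic to a $3$-chain group. -/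

import Mathlib

open scoped Topology

/-! ## One-manifolds and their orientation preserving homeomorphisms -/

/-- A topological one-manifold, possibly with boundary and possibly disconnected: a Hausdorff,
second countable space in which every point has an open neighbourhood homeomorphic to an open
subset of the half-line `[0, ∞)`. -/
structure IsOneManifold (M : Type*) [TopologicalSpace M] : Prop where
  t2 : T2Space M
  secondCountable : SecondCountableTopology M
  exists_chart : ∀ x : M, ∃ e : OpenPartialHomeomorph M (Set.Ici (0 : ℝ)), x ∈ e.source

/-- An orientation of a one-manifold `M`, given by coherent local orders: a relation `lt` that near
every point of `M` is the order pulled back by a local coordinate with values in `ℝ`. (The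
transition maps between these coordinates are then locally increasing.) Only the values of `lt`
near the diagonal matter for the notion of preserving the orientation. -/
structure OneOrientation (M : Type*) [TopologicalSpace M] where
  lt : M → M → Prop
  exists_coord : ∀ x : M, ∃ U ∈ 𝓝 x, ∃ φ : M → ℝ, ContinuousOn φ U ∧ Set.InjOn φ U ∧
    ∀ y ∈ U, ∀ z ∈ U, (lt y z ↔ φ y < φ z)

/-- `h` preserves the orientation `o`: near every point it preserves the local order. -/
def PreservesOrientation {M : Type*} [TopologicalSpace M] (o : OneOrientation M) (h : M ≃ₜ M) :
    Prop :=
  ∀ x : M, ∀ᶠ p in 𝓝 (x, x), (o.lt p.1 p.2 ↔ o.lt (h p.1) (h p.2))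

/-- `Homeo⁺(M)`: the group of orientation preserving homeomorphisms of an oriented one-manifold. -/
def HomeoPlus {M : Type*} [TopologicalSpace M] (o : OneOrientation M) : Subgroup (M ≃ₜ M) where
  carrier := {h | PreservesOrientation o h}
  one_mem' := fun x => Filter.Eventually.of_forall fun _ => Iff.rfl
  mul_mem' := by
    intro f g hf hg x
    have hc : Filter.Tendsto (fun p : M × M => (g p.1, g p.2)) (𝓝 (x, x)) (𝓝 (g x, g x)) :=
      ((g.continuous.comp continuous_fst).prodMk (g.continuous.comp continuous_snd)).tendsto (x, x)
    filter_upwards [hg x, hc.eventually (hf (g x))] with p h1 h2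
    exact h1.trans h2
  inv_mem' := by
    intro g hg x
    have hc : Filter.Tendsto (fun p : M × M => (g.symm p.1, g.symm p.2)) (𝓝 (x, x))
        (𝓝 (g.symm x, g.symm x)) :=
      ((g.symm.continuous.comp continuous_fst).prodMk
        (g.symm.continuous.comp continuous_snd)).tendsto (x, x)
    filter_upwards [hc.eventually (hg (g.symm x))] with p h1
    have h2 : o.lt (g.symm p.1) (g.symm p.2) ↔ o.lt p.1 p.2 := by simpa using h1
    exact h2.symm

/-! ## Chain groups

The orientation preserving homeomorphisms of `ℝ` are exactly its order automorphisms, so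
`Homeo⁺(ℝ)` is the group `ℝ ≃o ℝ` (with composition as multiplication). -/

/-- The translation `a(x) = x + 1`. -/
def thompsonA : ℝ ≃o ℝ := OrderIso.addRight 1

/-- The map `b(x) = x` for `x ≤ 0`, `b(x) = 2x` for `0 < x < 1`, `b(x) = x + 1` for `1 ≤ x`. -/
noncomputable def thompsonB : ℝ ≃o ℝ where
  toFun x := if x ≤ 0 then x else if x < 1 then 2 * x else x + 1
  invFun y := if y ≤ 0 then y else if y < 2 then y / 2 else y - 1
  left_inv x := by
    dsimp only
    split_ifs <;> linarith
  right_inv y := by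
    dsimp only
    split_ifs <;> linarith
  map_rel_iff' {x y} := by
    simp only [Equiv.coe_fn_mk]
    constructor <;> intro h <;> split_ifs at * <;> linarith

/-- Thompson's group `F = ⟨a, b⟩ ≤ Homeo⁺(ℝ)`. -/
noncomputable def thompsonF : Subgroup (ℝ ≃o ℝ) := Subgroup.closure {thompsonA, thompsonB}

/-- The (open) support of a homeomorphism of the line: the set of points that it moves. -/
def lineSupport (f : ℝ ≃o ℝ) : Set ℝ := {x | f x ≠ x}

/-- The left endpoint of a nonempty interval, possibly `-∞`. -/
noncomputable def leftEndpoint (J : Set ℝ) : EReal := sInf ((fun x : ℝ => (x : EReal)) '' J)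

/-- An `n`-chain of intervals: nonempty open intervals `J₁, …, Jₙ` of `ℝ` such that `Jᵢ` and `Jₖ`
are disjoint if `|i - k| > 1`, and `Jᵢ ∩ Jᵢ₊₁` is a nonempty proper subinterval of `Jᵢ` and of
`Jᵢ₊₁`. -/
structure IsChainOfIntervals {n : ℕ} (J : Fin n → Set ℝ) : Prop where
  isOpen : ∀ i, IsOpen (J i)
  ordConnected : ∀ i, (J i).OrdConnected
  nonempty : ∀ i, (J i).Nonempty
  disjoint : ∀ i k : Fin n, (i : ℕ) + 1 < (k : ℕ) → J i ∩ J k = ∅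
  inter_nonempty : ∀ i k : Fin n, (k : ℕ) = i + 1 → (J i ∩ J k).Nonempty
  inter_ssubset_left : ∀ i k : Fin n, (k : ℕ) = i + 1 → J i ∩ J k ⊂ J i
  inter_ssubset_right : ∀ i k : Fin n, (k : ℕ) = i + 1 → J i ∩ J k ⊂ J k

/-- `f₁, …, fₙ` generate an `n`-prechain group: `n ≥ 2` and there is a chain of intervals
`J₁, …, Jₙ`, listed with increasing left endpoints, such that `fᵢ` has support `Jᵢ` and satisfies
`fᵢ(t) ≥ t` for all `t`. -/
def IsPrechain {n : ℕ} (f : Fin n → (ℝ ≃o ℝ)) : Prop :=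
  2 ≤ n ∧ ∃ J : Fin n → Set ℝ, IsChainOfIntervals J ∧
    (∀ i k : Fin n, (k : ℕ) = i + 1 → leftEndpoint (J i) < leftEndpoint (J k)) ∧
    (∀ i, lineSupport (f i) = J i) ∧ ∀ i t, t ≤ f i t

/-- `G ≤ Homeo⁺(ℝ)` is an `n`-chain group: it is generated by `f₁, …, fₙ` as in a prechain group,
and `⟨fᵢ, fᵢ₊₁⟩` is isomorphic to Thompson's group `F` for each `i`. -/
def IsChainGroup (n : ℕ) (G : Subgroup (ℝ ≃o ℝ)) : Prop :=
  ∃ f : Fin n → (ℝ ≃o ℝ), IsPrechain f ∧ G = Subgroup.closure (Set.range f) ∧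
    ∀ i k : Fin n, (k : ℕ) = i + 1 → Nonempty (Subgroup.closure {f i, f k} ≃* thompsonF)

/-! Each set `A` of naturals is coded into a 3-chain group L_A on the line, generated by
`chainLeft`, `chainMid` and `chainRight A`, with supports (-∞, 0), (-1, 3) and (0, ∞). Only the
third generator depends on `A`: its germ at 0 records which of the gaps (2⁻ⁿ⁻², 2⁻ⁿ⁻¹) are moved by
`codeBump A`.

Consecutive generators f, g are so fast (`IsFastPair`) that g * f and g satisfy the relations of F.
Words in F have normal forms, and a point moved by x_m but fixed by all later x_l shows that no
normal form collapses; hence ⟨f, g⟩ ≅ F.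

The derived subgroup D_A is simple by Higman's argument (`isSimpleGroup_of_compressible`). It
consists of compactly supported maps; it is perfect, because the relations of F put the commutator
of the generators into the second derived subgroup; and it compresses bounded sets into arbitrary
intervals, because L_A does and D_A agrees with L_A on bounded sets.

The set `A` can be read off from the commutation relations of a suitable triple in D_A
(`exists_commutationCode_eq`). A countable group has only countably many triples, so each
isomorphism class of groups D_A comes from countably many sets `A`, and Cantor's theorem leaves
uncountably many classes.

Finally the homeomorphisms of the line act faithfully on any nonempty one-manifold, through a chart
and by the identity outside it, preserving orientation. This transports L_A and D_A. -/

open scoped commutatorElement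

/-! ## Thompson pairs -/

section ThompsonRelations

variable {G H : Type*} [Group G] [Group H]

/-- The elements `x₀ = a`, `xₙ₊₁ = aⁿ b a⁻ⁿ` of the standard infinite presentation of `F`. -/
def thompsonSeq (a b : G) : ℕ → G
  | 0 => a
  | n + 1 => a ^ n * b * (a ^ n)⁻¹

theorem conj_thompsonSeq_succ (a b : G) (k n : ℕ) :
    a ^ k * thompsonSeq a b (n + 1) * (a ^ k)⁻¹ = thompsonSeq a b (n + k + 1) := by
  simp only [thompsonSeq, add_comm n k, pow_add]
  group

/-- The hypothesis says that `a` and `b` conjugate every x_l with l ≥ 2 in the same way. Conjugation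
by `a` raises the index by one, hence so does conjugation by `b`, and conjugating by powers of `a`
gives the general case. -/
theorem thompsonSeq_conj {a b : G}
    (h : ∀ n : ℕ, Commute (a⁻¹ * b) (thompsonSeq a b (n + 2))) {m l : ℕ} (hml : m < l) :
    thompsonSeq a b m * thompsonSeq a b l * (thompsonSeq a b m)⁻¹ = thompsonSeq a b (l + 1) := by
  obtain ⟨d, rfl⟩ := Nat.exists_eq_add_of_lt hml
  cases m with
  | zero =>
    have := conj_thompsonSeq_succ a b 1 d
    simpa [thompsonSeq] using this
  | succ k =>
    have h1 : b * thompsonSeq a b (d + 2) * b⁻¹ = a * thompsonSeq a b (d + 2) * a⁻¹ := by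
      have h2 := (h d).eq
      calc b * thompsonSeq a b (d + 2) * b⁻¹
          = a * ((a⁻¹ * b) * thompsonSeq a b (d + 2)) * b⁻¹ := by group
        _ = a * (thompsonSeq a b (d + 2) * (a⁻¹ * b)) * b⁻¹ := by rw [h2]
        _ = _ := by group
    have h3 := conj_thompsonSeq_succ a b 1 (d + 1)
    have h4 := conj_thompsonSeq_succ a b k (d + 1)
    have h5 := conj_thompsonSeq_succ a b k (d + 2)
    rw [pow_one] at h3
    rw [show k + 1 + d + 1 = d + 1 + k + 1 by ring, ← h4,
      show d + 1 + k + 1 + 1 = d + 2 + k + 1 by ring, ← h5,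
      show d + 2 + 1 = d + 1 + 1 + 1 by ring, ← h3, ← h1]
    simp only [thompsonSeq]
    group

/-- `ThompsonForm x m k`: the element `k` is a product
`x_m^{-i_m} ⋯ x_n^{-i_n} x_n^{j_n} ⋯ x_m^{j_m}`. -/
inductive ThompsonForm (x : ℕ → G) : ℕ → G → Prop
  | one (m : ℕ) : ThompsonForm x m 1
  | step (m i j : ℕ) (k : G) (hk : ThompsonForm x (m + 1) k) :
      ThompsonForm x m ((x m ^ i)⁻¹ * k * x m ^ j)

namespace ThompsonForm

variable {x : ℕ → G}

theorem of_succ {m : ℕ} {k : G} (hk : ThompsonForm x (m + 1) k) : ThompsonForm x m k := by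
  simpa using step m 0 0 k hk

theorem of_add {m : ℕ} (d : ℕ) {k : G} (hk : ThompsonForm x (m + d) k) : ThompsonForm x m k := by
  induction d with
  | zero => exact hk
  | succ d ih => exact ih hk.of_succ

theorem conj (hx : ∀ m l, m < l → x m * x l * (x m)⁻¹ = x (l + 1)) {p : ℕ} {k : G}
    (hk : ThompsonForm x p k) {m : ℕ} (hm : m < p) :
    ThompsonForm x (p + 1) (x m * k * (x m)⁻¹) := by
  induction hk with
  | one p => simpa using one (p + 1)
  | step p i j k _ ih =>
    have := step (p + 1) i j _ (ih (by omega))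
    rw [← hx m p hm, conj_pow, conj_pow] at this
    convert this using 1
    group

theorem pow_conj (hx : ∀ m l, m < l → x m * x l * (x m)⁻¹ = x (l + 1)) {m l : ℕ} (hm : m < l)
    (i : ℕ) : x m ^ i * x l * (x m ^ i)⁻¹ = x (l + i) := by
  induction i with
  | zero => simp
  | succ i ih =>
    rw [← add_assoc, ← hx m (l + i) (by omega), ← ih, pow_succ']
    group

/-- Normal forms absorb a generator on the left. For l > m it passes the leading factor by x_l x_m⁻ⁱ
= x_m⁻ⁱ x_{l+i}. For l = m it changes the exponent i, except when x_m meets i = 0: then it is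
carried across the middle to the right end, raising the indices in between. -/
theorem gen_mul (hx : ∀ m l, m < l → x m * x l * (x m)⁻¹ = x (l + 1)) {m : ℕ} {k : G}
    (hk : ThompsonForm x m k) :
    ∀ l, m ≤ l → ThompsonForm x m (x l * k) ∧ ThompsonForm x m ((x l)⁻¹ * k) := by
  induction hk with
  | one m =>
    intro l hl
    obtain ⟨d, rfl⟩ := Nat.exists_eq_add_of_le hl
    constructor
    · refine of_add d ?_
      simpa using step (x := x) (m + d) 0 1 1 (one _)
    · refine of_add d ?_
      simpa using step (x := x) (m + d) 1 0 1 (one _)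
  | step m i j k hk ih =>
    intro l hl
    rcases hl.eq_or_lt with rfl | hl
    · constructor
      · cases i with
        | zero =>
          have := step m 0 (j + 1) _ (hk.conj hx (Nat.lt_succ_self m)).of_succ
          convert this using 1
          rw [pow_succ']
          group
        | succ i =>
          have := step m i j _ hk
          convert this using 1
          rw [pow_succ]
          group
      · have := step m (i + 1) j _ hk
        convert this using 1
        rw [pow_succ]
        group
    · have h1 := ih (l + i) (by omega)
      have h2 := pow_conj hx hl i
      constructor
      · have := step m i j _ h1.1
        convert this using 1
        rw [← h2]
        group
      · have := step m i j _ h1.2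
        convert this using 1
        rw [← h2]
        group

theorem of_mem_closure (hx : ∀ m l, m < l → x m * x l * (x m)⁻¹ = x (l + 1)) {k : G}
    (hk : k ∈ Subgroup.closure {x 0, x 1}) : ThompsonForm x 0 k := by
  induction hk using Subgroup.closure_induction_left with
  | one => exact one 0
  | mul_left y hy k _ ih =>
    rcases hy with rfl | rfl
    · exact (ih.gen_mul hx 0 le_rfl).1
    · exact (ih.gen_mul hx 1 zero_le_one).1
  | inv_mul_cancel y hy k _ ih =>
    rcases hy with rfl | rfl
    · exact (ih.gen_mul hx 0 le_rfl).2
    · exact (ih.gen_mul hx 1 zero_le_one).2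

theorem mem_closure {m : ℕ} {k : G} (hk : ThompsonForm x m k) :
    k ∈ Subgroup.closure (x '' Set.Ici m) := by
  induction hk with
  | one m => exact one_mem _
  | step m i j k _ ih =>
    have h1 : x m ∈ Subgroup.closure (x '' Set.Ici m) :=
      Subgroup.subset_closure ⟨m, Set.self_mem_Ici, rfl⟩
    have h2 : Subgroup.closure (x '' Set.Ici (m + 1)) ≤ Subgroup.closure (x '' Set.Ici m) :=
      Subgroup.closure_mono (Set.image_mono (Set.Ici_subset_Ici.2 (Nat.le_succ m)))
    exact mul_mem (mul_mem (inv_mem (pow_mem h1 _)) (h2 ih)) (pow_mem h1 _)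

/-- If the image of x_m⁻ⁱ k x_mʲ is trivial, then φ(x_m)^(i-j) = φ(k) lies in the image of the group
generated by the later x_l. The hypothesis forces i = j, so φ(k) = 1 and induction applies. -/
theorem eq_one_of_map_eq_one {φ : G →* H}
    (hφ : ∀ (m : ℕ) (z : ℤ), φ (x m) ^ z ∈
      (Subgroup.closure (x '' Set.Ici (m + 1))).map φ → z = 0)
    {m : ℕ} {k : G} (hk : ThompsonForm x m k) (h : φ k = 1) : k = 1 := by
  induction hk with
  | one m => rfl
  | step m i j k hk ih =>
    have h1 : φ k = φ (x m) ^ ((i : ℤ) - j) := by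
      rw [map_mul, map_mul, map_inv, map_pow, map_pow] at h
      rw [zpow_sub, zpow_natCast, zpow_natCast]
      have := congrArg (fun w => φ (x m) ^ i * w * (φ (x m) ^ j)⁻¹) h
      simpa [mul_assoc] using this
    have h2 : (i : ℤ) - j = 0 := hφ m _ (h1 ▸ ⟨k, hk.mem_closure, rfl⟩)
    have h3 : i = j := by omega
    rw [h2, zpow_zero] at h1
    rw [ih h1, h3]
    group

end ThompsonForm

/-! ### Second derived subgroups and the relations of F. -/

theorem conj_mem_commutator {L M : Subgroup G} (h : ∀ l ∈ L, ∀ y ∈ M, l * y * l⁻¹ ∈ M) :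
    ∀ l ∈ L, ∀ y ∈ ⁅M, M⁆, l * y * l⁻¹ ∈ ⁅M, M⁆ := by
  intro l hl y hy
  have h1 : M.map (MulAut.conj l).toMonoidHom ≤ M := by
    rintro _ ⟨w, hw, rfl⟩
    exact h l hl w hw
  refine Subgroup.commutator_mono h1 h1 ?_
  rw [← Subgroup.map_commutator]
  exact ⟨y, hy, rfl⟩

theorem conj_mem_derived (L : Subgroup G) : ∀ l ∈ L, ∀ y ∈ ⁅L, L⁆, l * y * l⁻¹ ∈ ⁅L, L⁆ :=
  conj_mem_commutator fun _ hl _ hy => mul_mem (mul_mem hl hy) (inv_mem hl)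

theorem conj_mem_secondDerived (L : Subgroup G) :
    ∀ l ∈ L, ∀ y ∈ ⁅⁅L, L⁆, ⁅L, L⁆⁆, l * y * l⁻¹ ∈ ⁅⁅L, L⁆, ⁅L, L⁆⁆ :=
  conj_mem_commutator (conj_mem_derived L)

/-- The relations of `F` force the commutator of the generators into the second derived subgroup. -/
theorem commutator_mem_of_thompson_relations {a b : G} (L : Subgroup G) (ha : a ∈ L) (hb : b ∈ L)
    (h : ∀ n : ℕ, Commute (a⁻¹ * b) (thompsonSeq a b (n + 2))) :
    ⁅a, b⁆ ∈ ⁅⁅L, L⁆, ⁅L, L⁆⁆ := by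
  have hx := fun m l => thompsonSeq_conj h (m := m) (l := l)
  set x := thompsonSeq a b with hxdef
  have hxL : ∀ n, x n ∈ L := by
    intro n
    cases n with
    | zero => exact ha
    | succ n => exact mul_mem (mul_mem (pow_mem ha _) hb) (inv_mem (pow_mem ha _))
  have h1 : x 2 * (x 1)⁻¹ ∈ ⁅L, L⁆ := by
    rw [← hx 0 1 (by norm_num)]
    exact Subgroup.commutator_mem_commutator (hxL 0) (hxL 1)
  have h3 : x 4 * (x 3)⁻¹ ∈ ⁅L, L⁆ := by
    rw [← hx 0 3 (by norm_num)]
    exact Subgroup.commutator_mem_commutator (hxL 0) (hxL 3)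
  have hnorm := conj_mem_secondDerived L
  have h5 := Subgroup.commutator_mem_commutator h1 h3
  -- A commutator of two elements of the derived subgroup. It is conjugate in `L` to x₃x₂⁻¹, hence
  -- to x₂x₁⁻¹, which is the commutator of x₀ = a and x₁ = b.
  have e1 : ⁅x 2 * (x 1)⁻¹, x 4 * (x 3)⁻¹⁆ = x 4 * (x 2)⁻¹ * x 3 * (x 4)⁻¹ := by
    have e2 : (x 1)⁻¹ * (x 4 * (x 3)⁻¹) * x 1 = x 3 * (x 2)⁻¹ := by
      rw [← hx 1 3 (by norm_num), ← hx 1 2 (by norm_num)]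
      group
    have e3 : x 2 * x 3 * (x 2)⁻¹ = x 4 := hx 2 3 (by norm_num)
    rw [commutatorElement_def]
    calc x 2 * (x 1)⁻¹ * (x 4 * (x 3)⁻¹) * (x 2 * (x 1)⁻¹)⁻¹ * (x 4 * (x 3)⁻¹)⁻¹
        = x 2 * ((x 1)⁻¹ * (x 4 * (x 3)⁻¹) * x 1) * (x 2)⁻¹ * (x 3 * (x 4)⁻¹) := by group
      _ = (x 2 * x 3 * (x 2)⁻¹) * (x 2)⁻¹ * (x 3 * (x 4)⁻¹) := by rw [e2]; group
      _ = _ := by rw [e3]; group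
  rw [e1] at h5
  have h6 := hnorm _ (hxL 2) _ (hnorm _ (inv_mem (hxL 4)) _ h5)
  have h7 := hnorm _ (inv_mem (hxL 0)) _ h6
  convert h7 using 1
  rw [commutatorElement_def]
  have e0 : a = x 0 := rfl
  have e0' : b = x 1 := by simp [hxdef, thompsonSeq]
  rw [e0, e0']
  have e4 := hx 0 1 (by norm_num)
  have e5 := hx 0 2 (by norm_num)
  rw [e4, ← e5]
  nth_rewrite 5 [← e4]
  group

end ThompsonRelations

/-! ### Pairs of homeomorphisms of the line that generate a copy of F. -/

theorem commute_of_disjoint_moved {f g : ℝ ≃o ℝ} (h : ∀ x, f x = x ∨ g x = x) : Commute f g := by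
  refine RelIso.ext fun x => ?_
  change f (g x) = g (f x)
  rcases h x with h1 | h1
  · rcases h (g x) with h2 | h2
    · rw [h1, h2]
    · rw [h1, g.injective h2, h1]
  · rcases h (f x) with h2 | h2
    · rw [h1, f.injective h2, h1]
    · rw [h1, h2]

/-- Dynamical conditions under which `A` and `B` generate a copy of Thompson's group. -/
structure IsThompsonPair (A B : ℝ ≃o ℝ) (q : ℝ) : Prop where
  le_apply : ∀ t, t ≤ A t
  apply_eq : ∀ t ≤ q, B t = t
  eq_of_le : ∀ t, A q ≤ t → B t = A t
  exists_left : ∃ t ≤ q, t < A t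
  exists_right : ∃ t ≤ A q, t < B t

namespace IsThompsonPair

variable {A B A' B' : ℝ ≃o ℝ} {q q' : ℝ}

theorem pow_mono (h : IsThompsonPair A B q) {m n : ℕ} (hmn : m ≤ n) (t : ℝ) :
    (A ^ m) t ≤ (A ^ n) t := by
  induction hmn with
  | refl => rfl
  | step _ ih => exact ih.trans (by rw [pow_succ']; exact h.le_apply _)

theorem thompsonSeq_apply (h : IsThompsonPair A B q) {n : ℕ} {t : ℝ} (ht : t ≤ (A ^ n) q) :
    thompsonSeq A B (n + 1) t = t := by
  have h1 : (A ^ n)⁻¹ t ≤ q := by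
    have := ((A ^ n)⁻¹).monotone ht
    rwa [← RelIso.mul_apply, inv_mul_cancel] at this
  change (A ^ n) (B ((A ^ n)⁻¹ t)) = t
  rw [h.apply_eq _ h1, ← RelIso.mul_apply, mul_inv_cancel, RelIso.one_apply]

/-- Disjoint supports: x_{n+2} fixes everything up to A q, while A⁻¹B fixes everything from A q on.
-/
theorem commute (h : IsThompsonPair A B q) (n : ℕ) :
    Commute (A⁻¹ * B) (thompsonSeq A B (n + 2)) := by
  refine commute_of_disjoint_moved fun x => ?_
  rcases le_total x (A q) with hx | hx
  · right
    refine h.thompsonSeq_apply (hx.trans ?_)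
    simpa using h.pow_mono (show 1 ≤ n + 1 by omega) q
  · left
    rw [RelIso.mul_apply, h.eq_of_le x hx, RelIso.inv_apply_self]

/-- The witness of independence: no nontrivial power of x_m fixes this point, but the whole group
generated by the later elements does. -/
theorem exists_moved (h : IsThompsonPair A B q) (m : ℕ) :
    ∃ t, t < thompsonSeq A B m t ∧ ∀ l, m < l → thompsonSeq A B l t = t := by
  cases m with
  | zero =>
    obtain ⟨t, ht, h1⟩ := h.exists_left
    refine ⟨t, h1, fun l hl => ?_⟩
    obtain ⟨n, rfl⟩ := Nat.exists_eq_add_of_lt hl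
    refine h.thompsonSeq_apply (ht.trans ?_)
    simpa using h.pow_mono (Nat.zero_le (0 + n)) q
  | succ m =>
    obtain ⟨t, ht, h1⟩ := h.exists_right
    refine ⟨(A ^ m) t, ?_, fun l hl => ?_⟩
    · change (A ^ m) t < (A ^ m) (B ((A ^ m)⁻¹ ((A ^ m) t)))
      rw [RelIso.inv_apply_self]
      exact (A ^ m).strictMono h1
    · obtain ⟨n, rfl⟩ := Nat.exists_eq_add_of_lt hl
      refine h.thompsonSeq_apply ?_
      calc (A ^ m) t ≤ (A ^ m) (A q) := (A ^ m).monotone ht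
        _ = (A ^ (m + 1)) q := by rw [pow_succ, RelIso.mul_apply]
        _ ≤ _ := h.pow_mono (by omega) q

theorem zpow_eq_zero {f : ℝ ≃o ℝ} {t : ℝ} (ht : t < f t) {z : ℤ} (hz : (f ^ z) t = t) : z = 0 := by
  have key : ∀ n : ℕ, t < (f ^ (n + 1)) t := by
    intro n
    induction n with
    | zero => simpa using ht
    | succ n ih =>
      rw [pow_succ', RelIso.mul_apply]
      exact ht.trans (f.strictMono ih)
  obtain ⟨n, rfl | rfl⟩ := z.eq_nat_or_neg
  · cases n with
    | zero => rfl
    | succ n =>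
      rw [zpow_natCast] at hz
      exact absurd hz (key n).ne'
  · cases n with
    | zero => rfl
    | succ n =>
      rw [zpow_neg, zpow_natCast] at hz
      have : (f ^ (n + 1)) t = t := by
        conv_lhs => rw [← hz]
        rw [RelIso.apply_inv_self]
      exact absurd this (key n).ne'

theorem injOn {G : Type*} [Group G] {a b : G} (φ : G →* (ℝ ≃o ℝ))
    (h : IsThompsonPair (φ a) (φ b) q)
    (hR : ∀ n : ℕ, Commute (a⁻¹ * b) (thompsonSeq a b (n + 2)))
    {k : G} (hk : k ∈ Subgroup.closure {a, b}) (hk1 : φ k = 1) : k = 1 := by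
  have hx := fun m l => thompsonSeq_conj hR (m := m) (l := l)
  have hφ : ∀ n, φ (thompsonSeq a b n) = thompsonSeq (φ a) (φ b) n := by
    intro n
    cases n <;> simp [thompsonSeq]
  have hk0 : k ∈ Subgroup.closure {thompsonSeq a b 0, thompsonSeq a b 1} := by
    simpa [thompsonSeq] using hk
  refine (ThompsonForm.of_mem_closure hx hk0).eq_one_of_map_eq_one (φ := φ) ?_ hk1
  intro m z hz
  obtain ⟨t, ht, hl⟩ := h.exists_moved m
  rw [hφ] at hz
  refine zpow_eq_zero ht ?_
  rw [MonoidHom.map_closure] at hz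
  have : ∀ w ∈ Subgroup.closure (φ '' (thompsonSeq a b '' Set.Ici (m + 1))), w t = t := by
    intro w hw
    induction hw using Subgroup.closure_induction with
    | mem w hw =>
      obtain ⟨_, ⟨l, hl', rfl⟩, rfl⟩ := hw
      rw [hφ]
      exact hl l hl'
    | one => rfl
    | mul u v _ _ hu hv => rw [RelIso.mul_apply, hv, hu]
    | inv u _ hu => rw [← hu, RelIso.inv_apply_self, hu]
  exact this _ hz

/-- The diagonal pair in the product satisfies the relations of F. Both projections are injective on
the group it generates, by `injOn`, so both images are isomorphic to that group. -/
theorem nonempty_mulEquiv (h : IsThompsonPair A B q) (h' : IsThompsonPair A' B' q') :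
    Nonempty (Subgroup.closure {A, B} ≃* Subgroup.closure {A', B'}) := by
  set a : (ℝ ≃o ℝ) × (ℝ ≃o ℝ) := (A, A') with ha
  set b : (ℝ ≃o ℝ) × (ℝ ≃o ℝ) := (B, B') with hb
  have hs : ∀ n, thompsonSeq a b n = (thompsonSeq A B n, thompsonSeq A' B' n) := by
    intro n
    cases n <;> simp [thompsonSeq, ha, hb]
  have hR : ∀ n : ℕ, Commute (a⁻¹ * b) (thompsonSeq a b (n + 2)) := by
    intro n
    rw [hs]
    exact Prod.ext (h.commute n).eq (h'.commute n).eq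
  have key : ∀ (φ : (ℝ ≃o ℝ) × (ℝ ≃o ℝ) →* (ℝ ≃o ℝ)) (p : ℝ), IsThompsonPair (φ a) (φ b) p →
      Nonempty (Subgroup.closure {a, b} ≃* Subgroup.closure {φ a, φ b}) := by
    intro φ p hp
    have e : Subgroup.closure {φ a, φ b} = (Subgroup.closure {a, b}).map φ := by
      rw [MonoidHom.map_closure, Set.image_pair]
    rw [e]
    refine ⟨MulEquiv.ofBijective (φ.subgroupMap (Subgroup.closure {a, b}))
      ⟨?_, φ.subgroupMap_surjective _⟩⟩
    rw [injective_iff_map_eq_one]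
    intro k hk
    exact Subtype.ext (hp.injOn φ hR k.2 (congrArg Subtype.val hk))
  obtain ⟨e⟩ := key (MonoidHom.fst _ _) q h
  obtain ⟨e'⟩ := key (MonoidHom.snd _ _) q' h'
  exact ⟨e.symm.trans e'⟩

end IsThompsonPair

theorem isThompsonPair_thompson : IsThompsonPair thompsonA thompsonB 0 where
  le_apply t := by simp [thompsonA]
  apply_eq t ht := by simp [thompsonB, ht]
  eq_of_le t ht := by
    simp only [thompsonA, OrderIso.addRight_apply, zero_add] at ht
    simp only [thompsonA, thompsonB, OrderIso.addRight_apply, RelIso.coe_fn_mk, Equiv.coe_fn_mk]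
    rw [if_neg (by linarith), if_neg (by linarith)]
  exists_left := ⟨0, le_rfl, by simp [thompsonA]⟩
  exists_right := ⟨1, by simp [thompsonA], by norm_num [thompsonB]⟩

/-- A fast pair: two positive homeomorphisms whose supports overlap like those of a `2`-chain. -/
structure IsFastPair (f g : ℝ ≃o ℝ) (q r : ℝ) : Prop where
  le_left : ∀ t, t ≤ f t
  le_right : ∀ t, t ≤ g t
  left_eq : ∀ t, r ≤ t → f t = t
  right_eq : ∀ t ≤ q, g t = t
  le_apply : r ≤ g (f q)
  exists_left : ∃ t ≤ q, t < f t
  exists_right : ∃ t ≤ r, t < g t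

namespace IsFastPair

variable {f g : ℝ ≃o ℝ} {q r : ℝ}

theorem isThompsonPair (h : IsFastPair f g q r) : IsThompsonPair (g * f) g q where
  le_apply t := (h.le_left t).trans (h.le_right _)
  apply_eq := h.right_eq
  eq_of_le t ht := by
    rw [RelIso.mul_apply, h.left_eq t (h.le_apply.trans ht)]
  exists_left := by
    obtain ⟨t, ht, h1⟩ := h.exists_left
    exact ⟨t, ht, h1.trans_le (h.le_right _)⟩
  exists_right := by
    obtain ⟨t, ht, h1⟩ := h.exists_right
    exact ⟨t, ht.trans h.le_apply, h1⟩

theorem nonempty_mulEquiv (h : IsFastPair f g q r) :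
    Nonempty (Subgroup.closure {f, g} ≃* thompsonF) := by
  have e : Subgroup.closure {f, g} = Subgroup.closure {g * f, g} := by
    apply le_antisymm <;> rw [Subgroup.closure_le, Set.insert_subset_iff, Set.singleton_subset_iff]
    · have h1 : g * f ∈ Subgroup.closure {g * f, g} := Subgroup.subset_closure (by simp)
      have h2 : g ∈ Subgroup.closure {g * f, g} := Subgroup.subset_closure (by simp)
      exact ⟨by simpa using mul_mem (inv_mem h2) h1, h2⟩
    · have h1 : f ∈ Subgroup.closure {f, g} := Subgroup.subset_closure (by simp)
      have h2 : g ∈ Subgroup.closure {f, g} := Subgroup.subset_closure (by simp)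
      exact ⟨mul_mem h2 h1, h2⟩
  rw [e]
  exact h.isThompsonPair.nonempty_mulEquiv isThompsonPair_thompson

/-- ⁅f, g⁆ is the conjugate by g⁻¹ of ⁅g * f, g⁆, the commutator of the Thompson pair. -/
theorem commutator_mem (h : IsFastPair f g q r) {L : Subgroup (ℝ ≃o ℝ)} (hf : f ∈ L) (hg : g ∈ L) :
    ⁅f, g⁆ ∈ ⁅⁅L, L⁆, ⁅L, L⁆⁆ := by
  have h1 := commutator_mem_of_thompson_relations L (mul_mem hg hf) hg h.isThompsonPair.commute
  have h2 := conj_mem_secondDerived L _ (inv_mem hg) _ h1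
  convert h2 using 1
  simp only [commutatorElement_def]
  group

end IsFastPair

/-! ## Simplicity of compressible groups of homeomorphisms -/

/-- From ⁅c, uv⁆ = ⁅c, u⁆ · u⁅c, v⁆u⁻¹: for a subgroup normalised by the closure, commutators of
generators suffice. -/
theorem commutator_closure_le {G : Type*} [Group G] {S : Set G} {N : Subgroup G}
    (hN : ∀ l ∈ Subgroup.closure S, ∀ y ∈ N, l * y * l⁻¹ ∈ N)
    (hS : ∀ s ∈ S, ∀ t ∈ S, ⁅s, t⁆ ∈ N) :
    ⁅Subgroup.closure S, Subgroup.closure S⁆ ≤ N := by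
  have key : ∀ c : G, (∀ s ∈ S, ⁅c, s⁆ ∈ N) → ∀ g ∈ Subgroup.closure S, ⁅c, g⁆ ∈ N := by
    intro c hc g hg
    induction hg using Subgroup.closure_induction with
    | mem s hs => exact hc s hs
    | one => rw [commutatorElement_one_right]; exact one_mem _
    | mul u v hu _ h1 h2 =>
      have := mul_mem h1 (hN u hu _ h2)
      convert this using 1
      simp only [commutatorElement_def]
      group
    | inv u hu h1 =>
      have := hN _ (inv_mem hu) _ (inv_mem h1)
      convert this using 1
      simp only [commutatorElement_def]
      group
  rw [Subgroup.commutator_le]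
  intro g hg g' hg'
  refine key g (fun s hs => ?_) g' hg'
  rw [← commutatorElement_inv]
  exact inv_mem (key s (hS s hs) g hg)

/-- The homeomorphisms of the line with compact support. -/
def compactHomeo : Subgroup (ℝ ≃o ℝ) where
  carrier := {f | ∃ R : ℝ, ∀ x, R ≤ |x| → f x = x}
  one_mem' := ⟨0, fun _ _ => rfl⟩
  mul_mem' := by
    rintro f g ⟨R, hR⟩ ⟨R', hR'⟩
    refine ⟨max R R', fun x hx => ?_⟩
    rw [RelIso.mul_apply, hR' x ((le_max_right _ _).trans hx), hR x ((le_max_left _ _).trans hx)]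
  inv_mem' := by
    rintro f ⟨R, hR⟩
    refine ⟨R, fun x hx => ?_⟩
    conv_lhs => rw [← hR x hx]
    rw [RelIso.inv_apply_self]

theorem conj_mem_compactHomeo (l : ℝ ≃o ℝ) {f : ℝ ≃o ℝ} (hf : f ∈ compactHomeo) :
    l * f * l⁻¹ ∈ compactHomeo := by
  obtain ⟨R, hR⟩ := hf
  refine ⟨max (|l R|) (|l (-R)|) + 1, fun x hx => ?_⟩
  have h1 : R ≤ |l⁻¹ x| := by
    by_contra! h2
    rw [abs_lt] at h2
    have h3 := l.strictMono h2.1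
    have h4 := l.strictMono h2.2
    rw [RelIso.apply_inv_self] at h3 h4
    have h5 : |x| ≤ max (|l R|) (|l (-R)|) := by
      rw [abs_le]
      constructor
      · have := neg_abs_le (l (-R))
        have := le_max_right (|l R|) (|l (-R)|)
        linarith
      · have := le_abs_self (l R)
        have := le_max_left (|l R|) (|l (-R)|)
        linarith
    linarith
  rw [RelIso.mul_apply, RelIso.mul_apply, hR _ h1, RelIso.apply_inv_self]

theorem conj_apply_eq_of_notMem {g a : ℝ ≃o ℝ} {R u v x : ℝ} (ha : ∀ x, R ≤ |x| → a x = x)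
    (hu : u ≤ g (-R)) (hv : g R ≤ v) (hx : x ≤ u ∨ v ≤ x) : (g * a * g⁻¹) x = x := by
  have h1 : R ≤ |g⁻¹ x| := by
    rw [le_abs]
    rcases hx with hx | hx
    · right
      have := (g⁻¹).monotone (hx.trans hu)
      rw [RelIso.inv_apply_self] at this
      linarith
    · left
      have := (g⁻¹).monotone (hv.trans hx)
      rwa [RelIso.inv_apply_self] at this
  rw [RelIso.mul_apply, RelIso.mul_apply, ha _ h1, RelIso.apply_inv_self]

theorem exists_displaced_interval {n : ℝ ≃o ℝ} {x : ℝ} (h : x < n x) :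
    ∃ u v, u < v ∧ v < n u := by
  obtain ⟨y, h1, h2⟩ := exists_between h
  have h3 : ∀ᶠ u in 𝓝[<] x, y < n u :=
    (n.continuous.continuousAt.eventually (lt_mem_nhds h2)).filter_mono nhdsWithin_le_nhds
  obtain ⟨u, hu, hux⟩ := (h3.and self_mem_nhdsWithin).exists
  exact ⟨u, y, lt_trans hux h1, hu⟩

/-- Higman's argument: a perfect group of compactly supported homeomorphisms of the line that
moves every bounded set into every interval is simple. -/
theorem isSimpleGroup_of_compressible {P : Subgroup (ℝ ≃o ℝ)} (hne : P ≠ ⊥)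
    (hP : P ≤ compactHomeo) (hperf : P ≤ ⁅P, P⁆)
    (hcomp : ∀ R u v : ℝ, u < v → ∃ g ∈ P, u < g (-R) ∧ g R < v) : IsSimpleGroup P := by
  have : Nontrivial P := (Subgroup.nontrivial_iff_ne_bot P).2 hne
  refine ⟨fun N hN => ?_⟩
  by_cases hbot : N = ⊥
  · exact Or.inl hbot
  right
  obtain ⟨⟨n₀, hn₀P⟩, hn₀N, hn₀⟩ := N.ne_bot_iff_exists_ne_one.1 hbot |>.elim
    fun a ha => (⟨a.1, a.2, fun h => ha (Subtype.ext h)⟩ : ∃ n ∈ N, n ≠ 1)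
  obtain ⟨n, hnP, hnN, x, hx⟩ : ∃ (n : ℝ ≃o ℝ) (hnP : n ∈ P), (⟨n, hnP⟩ : P) ∈ N ∧
      ∃ x, x < n x := by
    have h1 : ∃ x, n₀ x ≠ x := by
      by_contra! h
      exact hn₀ (Subtype.ext (RelIso.ext h))
    obtain ⟨x, hx⟩ := h1
    rcases lt_or_gt_of_ne hx with h | h
    · refine ⟨n₀⁻¹, inv_mem hn₀P, inv_mem hn₀N, n₀ x, ?_⟩
      rwa [RelIso.inv_apply_self]
    · exact ⟨n₀, hn₀P, hn₀N, x, h⟩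
  obtain ⟨u, v, huv, hvn⟩ := exists_displaced_interval hx
  have key : ⁅P, P⁆ ≤ N.map P.subtype := by
    rw [Subgroup.commutator_le]
    intro a ha b hb
    obtain ⟨R₁, hR₁⟩ := hP (inv_mem ha)
    obtain ⟨R₂, hR₂⟩ := hP hb
    obtain ⟨g, hgP, hgu, hgv⟩ := hcomp (max R₁ R₂) u v huv
    -- The inverse of `a` is conjugated because a'⁻¹ is what survives in the double commutator
    -- below. Both a' and b' are supported in (u, v).
    set a' : ℝ ≃o ℝ := g * a⁻¹ * g⁻¹ with ha'
    set b' : ℝ ≃o ℝ := g * b * g⁻¹ with hb'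
    have ha'P : a' ∈ P := mul_mem (mul_mem hgP (inv_mem ha)) (inv_mem hgP)
    have hb'P : b' ∈ P := mul_mem (mul_mem hgP hb) (inv_mem hgP)
    have ha'x : ∀ x, x ≤ u ∨ v ≤ x → a' x = x := fun x hx =>
      conj_apply_eq_of_notMem (fun x h => hR₁ x ((le_max_left _ _).trans h)) hgu.le hgv.le hx
    have hb'x : ∀ x, x ≤ u ∨ v ≤ x → b' x = x := fun x hx =>
      conj_apply_eq_of_notMem (fun x h => hR₂ x ((le_max_right _ _).trans h)) hgu.le hgv.le hx
    -- Since n u > v, the support of α lies above v, so α commutes with a' and b'. Thus ⁅n, a'⁆ = α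
    -- a'⁻¹, and α drops out of the commutator with b'.
    set α : ℝ ≃o ℝ := n * a' * n⁻¹ with hα
    have hαx : ∀ x, x ≤ v → α x = x := by
      intro x hx
      have h1 : n⁻¹ x ≤ u := by
        have := (n⁻¹).monotone (hx.trans hvn.le)
        rwa [RelIso.inv_apply_self] at this
      rw [hα, RelIso.mul_apply, RelIso.mul_apply, ha'x _ (Or.inl h1), RelIso.apply_inv_self]
    have hcomm : ∀ c : ℝ ≃o ℝ, (∀ x, x ≤ u ∨ v ≤ x → c x = x) → Commute α c := by
      intro c hc
      refine commute_of_disjoint_moved fun x => ?_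
      rcases le_total x v with h | h
      · exact Or.inl (hαx x h)
      · exact Or.inr (hc x (Or.inr h))
    have hαa := hcomm a' ha'x
    have hαb := hcomm b' hb'x
    have h1 : ⁅(⟨n, hnP⟩ : P), (⟨a', ha'P⟩ : P)⁆ ∈ N := by
      rw [commutatorElement_def, mul_assoc, mul_assoc, ← mul_assoc (⟨a', ha'P⟩ : P)]
      exact mul_mem hnN (hN.conj_mem _ (inv_mem hnN) _)
    have h2 : (⁅⁅(⟨n, hnP⟩ : P), (⟨a', ha'P⟩ : P)⁆, (⟨b', hb'P⟩ : P)⁆ : P) ∈ N := by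
      rw [commutatorElement_def, mul_assoc, mul_assoc, ← mul_assoc (⟨b', hb'P⟩ : P)]
      exact mul_mem h1 (hN.conj_mem _ (inv_mem h1) _)
    have h3 := hN.conj_mem _ h2 ⟨g⁻¹, inv_mem hgP⟩
    refine ⟨_, h3, ?_⟩
    have e1 : ⁅⁅n, a'⁆, b'⁆ = ⁅a'⁻¹, b'⁆ := by
      have : ⁅n, a'⁆ = α * a'⁻¹ := by rw [commutatorElement_def]
      rw [this, commutatorElement_def, commutatorElement_def]
      have h4 : α * (a'⁻¹ * b' * a') = (a'⁻¹ * b' * a') * α :=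
        ((hαa.inv_right.mul_right hαb).mul_right hαa).eq
      calc α * a'⁻¹ * b' * (α * a'⁻¹)⁻¹ * b'⁻¹ = α * (a'⁻¹ * b' * a') * α⁻¹ * b'⁻¹ := by group
        _ = _ := by rw [h4]; group
    have e2 : ⁅a'⁻¹, b'⁆ = g * ⁅a, b⁆ * g⁻¹ := by
      simp only [commutatorElement_def, ha', hb']
      group
    change g⁻¹ * ⁅⁅n, a'⁆, b'⁆ * g⁻¹⁻¹ = ⁅a, b⁆
    rw [e1, e2]
    group
  rw [eq_top_iff]
  rintro ⟨a, ha⟩ -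
  obtain ⟨⟨a', ha'⟩, h1, h2⟩ := key (hperf ha)
  obtain rfl : a' = a := h2
  exact h1

/-- A positive homeomorphism without fixed points in `[x, y]` moves `x` beyond `y`. -/
theorem exists_lt_pow_apply {f : ℝ ≃o ℝ} {x y : ℝ} (h : ∀ t, x ≤ t → t ≤ y → t < f t) :
    ∃ n : ℕ, y < (f ^ n) x := by
  by_contra! hn
  have hstep : ∀ n, (f ^ (n + 1)) x = f ((f ^ n) x) := fun n => by
    rw [pow_succ', RelIso.mul_apply]
  have hx : ∀ n, x ≤ (f ^ n) x := by
    intro n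
    induction n with
    | zero => exact le_rfl
    | succ n ih => rw [hstep]; exact ih.trans (h _ ih (hn n)).le
  have hmono : Monotone fun n : ℕ => (f ^ n) x :=
    monotone_nat_of_le_succ fun n => by
      rw [hstep]; exact (h _ (hx n) (hn n)).le
  have hlim := tendsto_atTop_ciSup hmono ⟨y, by rintro _ ⟨n, rfl⟩; exact hn n⟩
  set z := ⨆ n : ℕ, (f ^ n) x
  have h1 : x ≤ z := ge_of_tendsto' hlim hx
  have h2 : z ≤ y := le_of_tendsto' hlim hn
  have h3 := (f.continuous.tendsto z).comp hlim
  have h4 := hlim.comp (Filter.tendsto_add_atTop_nat 1)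
  have h5 : f z = z := by
    refine tendsto_nhds_unique h3 (h4.congr fun n => ?_)
    exact hstep n
  exact (h z h1 h2).ne' h5

/-! ## A family of three-chain groups -/

/-- The homeomorphism with support `(-∞, 0)` that is `x + 1` on `(-∞, -2]` and `x / 2` on
`[-2, 0]`. -/
noncomputable def chainLeft : ℝ ≃o ℝ where
  toFun x := if x ≤ -2 then x + 1 else if x ≤ 0 then x / 2 else x
  invFun y := if y ≤ -1 then y - 1 else if y ≤ 0 then 2 * y else y
  left_inv x := by
    dsimp only
    split_ifs <;> linarith
  right_inv y := by
    dsimp only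
    split_ifs <;> linarith
  map_rel_iff' {x y} := by
    simp only [Equiv.coe_fn_mk]
    constructor <;> intro h <;> split_ifs at * <;> linarith

/-- The homeomorphism with support `(-1, 3)` that is `2 x + 1` on `[-1, 0]`, `x + 1` on `[0, 1]`
and `(x + 3) / 2` on `[1, 3]`. -/
noncomputable def chainMid : ℝ ≃o ℝ where
  toFun x := if x ≤ -1 then x else if x ≤ 0 then 2 * x + 1 else if x ≤ 1 then x + 1 else
    if x ≤ 3 then (x + 3) / 2 else x
  invFun y := if y ≤ -1 then y else if y ≤ 1 then (y - 1) / 2 else if y ≤ 2 then y - 1 else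
    if y ≤ 3 then 2 * y - 3 else y
  left_inv x := by
    dsimp only
    split_ifs <;> linarith
  right_inv y := by
    dsimp only
    split_ifs <;> linarith
  map_rel_iff' {x y} := by
    simp only [Equiv.coe_fn_mk]
    constructor <;> intro h <;> split_ifs at * <;> linarith

/-- The homeomorphism with support `(0, ∞)` that is `2 x` on `[0, 1/2]` and `4 x - 1` on
`[1/2, ∞)`. -/
noncomputable def rightDilation : ℝ ≃o ℝ where
  toFun x := if x ≤ 0 then x else if x ≤ 1 / 2 then 2 * x else 4 * x - 1
  invFun y := if y ≤ 0 then y else if y ≤ 1 then y / 2 else (y + 1) / 4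
  left_inv x := by
    dsimp only
    split_ifs <;> linarith
  right_inv y := by
    dsimp only
    split_ifs <;> linarith
  map_rel_iff' {x y} := by
    simp only [Equiv.coe_fn_mk]
    constructor <;> intro h <;> split_ifs at * <;> linarith

theorem chainLeft_apply (x : ℝ) :
    chainLeft x = if x ≤ -2 then x + 1 else if x ≤ 0 then x / 2 else x := rfl

theorem chainMid_apply (x : ℝ) :
    chainMid x = if x ≤ -1 then x else if x ≤ 0 then 2 * x + 1 else if x ≤ 1 then x + 1 else
      if x ≤ 3 then (x + 3) / 2 else x := rfl

theorem rightDilation_apply (x : ℝ) :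
    rightDilation x = if x ≤ 0 then x else if x ≤ 1 / 2 then 2 * x else 4 * x - 1 := rfl

theorem chainLeft_of_nonneg {x : ℝ} (h : 0 ≤ x) : chainLeft x = x := by
  rw [chainLeft_apply]; split_ifs <;> linarith

theorem lt_chainLeft {x : ℝ} (h : x < 0) : x < chainLeft x := by
  rw [chainLeft_apply]; split_ifs <;> linarith

theorem chainLeft_eq_half {x : ℝ} (h : -2 ≤ x) (h' : x ≤ 0) : chainLeft x = x / 2 := by
  rw [chainLeft_apply]; split_ifs <;> linarith

theorem chainMid_of_le {x : ℝ} (h : x ≤ -1) : chainMid x = x := by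
  rw [chainMid_apply]; split_ifs; rfl

theorem chainMid_of_ge {x : ℝ} (h : 3 ≤ x) : chainMid x = x := by
  rw [chainMid_apply]; split_ifs <;> linarith

theorem chainMid_eq_double {x : ℝ} (h : -1 ≤ x) (h' : x ≤ 0) : chainMid x = 2 * x + 1 := by
  rw [chainMid_apply]; split_ifs <;> linarith

theorem lt_chainMid {x : ℝ} (h : -1 < x) (h' : x < 3) : x < chainMid x := by
  rw [chainMid_apply]; split_ifs <;> linarith

theorem rightDilation_of_nonpos {x : ℝ} (h : x ≤ 0) : rightDilation x = x := by
  rw [rightDilation_apply]; split_ifs; rfl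

theorem lt_rightDilation {x : ℝ} (h : 0 < x) : x < rightDilation x := by
  rw [rightDilation_apply]; split_ifs <;> linarith

theorem rightDilation_eq_double {x : ℝ} (h : 0 ≤ x) (h' : x ≤ 1 / 2) :
    rightDilation x = 2 * x := by
  rw [rightDilation_apply]; split_ifs <;> linarith

/-! ### Homeomorphisms with prescribed fixed points and the coding generator. -/

/-- The map `x ↦ x + dist(x, C) / 2`: a positive homeomorphism with fixed point set `C`. -/
noncomputable def bump (C : Set ℝ) (hC : C.Nonempty) : ℝ ≃o ℝ :=
  StrictMono.orderIsoOfSurjective (fun x => x + Metric.infDist x C / 2)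
    -- The distance to `C` is 1-Lipschitz, so half of it cannot cancel the growth of x.
    (fun x y hxy => by
      have h1 := Metric.infDist_le_infDist_add_dist (s := C) (x := x) (y := y)
      rw [Real.dist_eq, abs_of_neg (by linarith)] at h1
      change x + Metric.infDist x C / 2 < y + Metric.infDist y C / 2
      linarith)
    (fun y => by
      obtain ⟨c, hc⟩ := hC
      have hcont : Continuous fun x : ℝ => x + Metric.infDist x C / 2 :=
        continuous_id.add ((Metric.continuous_infDist_pt C).div_const 2)
      refine intermediate_value_univ (y - |y - c|) y hcont ⟨?_, ?_⟩
      · have h1 := Metric.infDist_le_dist_of_mem (x := y - |y - c|) hc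
        have h2 : dist (y - |y - c|) c ≤ 2 * |y - c| := by
          rw [Real.dist_eq, show y - |y - c| - c = (y - c) - |y - c| by ring]
          calc _ ≤ |y - c| + |(|y - c|)| := abs_sub _ _
            _ = _ := by rw [abs_abs]; ring
        linarith
      · have := Metric.infDist_nonneg (x := y) (s := C)
        linarith)

theorem bump_apply {C : Set ℝ} (hC : C.Nonempty) (x : ℝ) :
    bump C hC x = x + Metric.infDist x C / 2 := rfl

theorem le_bump {C : Set ℝ} (hC : C.Nonempty) (x : ℝ) : x ≤ bump C hC x := by
  have := Metric.infDist_nonneg (x := x) (s := C)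
  rw [bump_apply]
  linarith

theorem bump_of_mem {C : Set ℝ} (hC : C.Nonempty) {x : ℝ} (hx : x ∈ C) : bump C hC x = x := by
  rw [bump_apply, Metric.infDist_zero_of_mem hx]
  ring

theorem lt_bump {C : Set ℝ} (hC : C.Nonempty) (hcl : IsClosed C) {x : ℝ} (hx : x ∉ C) :
    x < bump C hC x := by
  have := (hcl.notMem_iff_infDist_pos hC).1 hx
  rw [bump_apply]
  linarith

/-- The union of the dyadic gaps `(2⁻ⁿ⁻², 2⁻ⁿ⁻¹)` for `n ∈ A`. -/
def dyadicGaps (A : Set ℕ) : Set ℝ :=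
  ⋃ n ∈ A, Set.Ioo ((1 / 2 : ℝ) ^ (n + 2)) ((1 / 2 : ℝ) ^ (n + 1))

theorem isOpen_dyadicGaps (A : Set ℕ) : IsOpen (dyadicGaps A) :=
  isOpen_biUnion fun _ _ => isOpen_Ioo

theorem pos_of_mem_dyadicGaps {A : Set ℕ} {x : ℝ} (hx : x ∈ dyadicGaps A) : 0 < x := by
  simp only [dyadicGaps, Set.mem_iUnion] at hx
  obtain ⟨n, -, hn⟩ := hx
  exact lt_trans (by positivity) hn.1

theorem mem_of_mem_dyadicGaps {A : Set ℕ} {n : ℕ} {x : ℝ} (hx : x ∈ dyadicGaps A)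
    (h1 : (1 / 2 : ℝ) ^ (n + 2) ≤ x) (h2 : x ≤ (1 / 2 : ℝ) ^ (n + 1)) :
    n ∈ A ∧ (1 / 2 : ℝ) ^ (n + 2) < x ∧ x < (1 / 2 : ℝ) ^ (n + 1) := by
  simp only [dyadicGaps, Set.mem_iUnion] at hx
  obtain ⟨m, hm, h3, h4⟩ := hx
  have h5 := lt_of_le_of_lt h1 h4
  have h6 := lt_of_lt_of_le h3 h2
  rw [pow_lt_pow_iff_right_of_lt_one₀ (by norm_num) (by norm_num)] at h5 h6
  obtain rfl : m = n := by omega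
  exact ⟨hm, h3, h4⟩

theorem dyadicGaps_compl_nonempty (A : Set ℕ) : (dyadicGaps A)ᶜ.Nonempty :=
  ⟨0, fun h => lt_irrefl _ (pos_of_mem_dyadicGaps h)⟩

/-- The homeomorphism that moves exactly the points of the dyadic gaps coded by `A`. -/
noncomputable def codeBump (A : Set ℕ) : ℝ ≃o ℝ :=
  bump (dyadicGaps A)ᶜ (dyadicGaps_compl_nonempty A)

theorem le_codeBump (A : Set ℕ) (x : ℝ) : x ≤ codeBump A x := le_bump _ x

theorem codeBump_of_notMem {A : Set ℕ} {x : ℝ} (hx : x ∉ dyadicGaps A) : codeBump A x = x :=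
  bump_of_mem _ hx

theorem lt_codeBump {A : Set ℕ} {x : ℝ} (hx : x ∈ dyadicGaps A) : x < codeBump A x :=
  lt_bump _ (isOpen_dyadicGaps A).isClosed_compl (fun h => h hx)

theorem pow_half_notMem_dyadicGaps (A : Set ℕ) (n : ℕ) :
    (1 / 2 : ℝ) ^ (n + 1) ∉ dyadicGaps A := fun h =>
  lt_irrefl _ (mem_of_mem_dyadicGaps h
    (pow_le_pow_of_le_one (by norm_num) (by norm_num) (by omega)) le_rfl).2.2

/-- The third generator, with support `(0, ∞)`, whose germ at `0` codes `A`. -/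
noncomputable def chainRight (A : Set ℕ) : ℝ ≃o ℝ := rightDilation * codeBump A

theorem chainRight_of_nonpos (A : Set ℕ) {x : ℝ} (hx : x ≤ 0) : chainRight A x = x := by
  rw [chainRight, RelIso.mul_apply,
    codeBump_of_notMem fun h => (pos_of_mem_dyadicGaps h).not_ge hx, rightDilation_of_nonpos hx]

theorem rightDilation_le_chainRight (A : Set ℕ) (x : ℝ) : rightDilation x ≤ chainRight A x :=
  rightDilation.monotone (le_codeBump A x)

theorem lt_chainRight (A : Set ℕ) {x : ℝ} (hx : 0 < x) : x < chainRight A x :=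
  (lt_rightDilation hx).trans_le (rightDilation_le_chainRight A x)

theorem le_chainLeft (x : ℝ) : x ≤ chainLeft x := by
  rcases lt_or_ge x 0 with h | h
  · exact (lt_chainLeft h).le
  · exact (chainLeft_of_nonneg h).ge

theorem le_chainMid (x : ℝ) : x ≤ chainMid x := by
  rcases le_or_gt x (-1) with h | h
  · exact (chainMid_of_le h).ge
  · rcases lt_or_ge x 3 with h' | h'
    · exact (lt_chainMid h h').le
    · exact (chainMid_of_ge h').ge

theorem le_chainRight (A : Set ℕ) (x : ℝ) : x ≤ chainRight A x := by
  rcases le_or_gt x 0 with h | h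
  · exact (chainRight_of_nonpos A h).ge
  · exact (lt_chainRight A h).le

theorem isFastPair_left_mid : IsFastPair chainLeft chainMid (-1) 0 where
  le_left := le_chainLeft
  le_right := le_chainMid
  left_eq _ := chainLeft_of_nonneg
  right_eq _ := chainMid_of_le
  le_apply := by norm_num [chainLeft_apply, chainMid_apply]
  exists_left := ⟨-1, le_rfl, lt_chainLeft (by norm_num)⟩
  exists_right := ⟨0, le_rfl, lt_chainMid (by norm_num) (by norm_num)⟩

theorem isFastPair_mid_right (A : Set ℕ) : IsFastPair chainMid (chainRight A) 0 3 where
  le_left := le_chainMid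
  le_right := le_chainRight A
  left_eq _ := chainMid_of_ge
  right_eq _ := chainRight_of_nonpos A
  -- `chainMid` sends 0 to 1 and `rightDilation` sends 1 to exactly 3; this is the purpose of the
  -- slope 4 beyond 1/2.
  le_apply := le_trans (by norm_num [rightDilation_apply, chainMid_apply])
    (rightDilation_le_chainRight A _)
  exists_left := ⟨0, le_rfl, lt_chainMid (by norm_num) (by norm_num)⟩
  exists_right := ⟨3, le_rfl, lt_chainRight A (by norm_num)⟩

/-- The generators of the three-chain group coded by `A`. -/
noncomputable def chainGenerators (A : Set ℕ) : Fin 3 → (ℝ ≃o ℝ) :=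
  ![chainLeft, chainMid, chainRight A]

/-- The three-chain group coded by `A`. -/
noncomputable def codedChainGroup (A : Set ℕ) : Subgroup (ℝ ≃o ℝ) :=
  Subgroup.closure (Set.range (chainGenerators A))

/-! ### Verification of the chain conditions. -/

theorem leftEndpoint_lt {I J : Set ℝ} {x y : ℝ} (hx : x ∈ I) (hxy : x < y)
    (hy : ∀ z ∈ J, y ≤ z) : leftEndpoint I < leftEndpoint J := by
  refine lt_of_le_of_lt (sInf_le ⟨x, hx, rfl⟩) (lt_of_lt_of_le (EReal.coe_lt_coe_iff.2 hxy) ?_)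
  refine le_sInf ?_
  rintro _ ⟨z, hz, rfl⟩
  exact EReal.coe_le_coe_iff.2 (hy z hz)

theorem lineSupport_chainLeft : lineSupport chainLeft = Set.Iio 0 := by
  ext x
  refine ⟨fun h => ?_, fun h => (lt_chainLeft h).ne'⟩
  by_contra h'
  exact h (chainLeft_of_nonneg (not_lt.1 h'))

theorem lineSupport_chainMid : lineSupport chainMid = Set.Ioo (-1) 3 := by
  ext x
  refine ⟨fun h => ⟨?_, ?_⟩, fun h => (lt_chainMid h.1 h.2).ne'⟩
  · by_contra h'
    exact h (chainMid_of_le (not_lt.1 h'))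
  · by_contra h'
    exact h (chainMid_of_ge (not_lt.1 h'))

theorem lineSupport_chainRight (A : Set ℕ) : lineSupport (chainRight A) = Set.Ioi 0 := by
  ext x
  refine ⟨fun h => ?_, fun h => (lt_chainRight A h).ne'⟩
  by_contra h'
  exact h (chainRight_of_nonpos A (not_lt.1 h'))

theorem isChainOfIntervals_chain :
    IsChainOfIntervals (![Set.Iio 0, Set.Ioo (-1) 3, Set.Ioi 0] : Fin 3 → Set ℝ) where
  isOpen i := by
    fin_cases i
    · exact isOpen_Iio
    · exact isOpen_Ioo
    · exact isOpen_Ioi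
  ordConnected i := by
    fin_cases i
    · exact Set.ordConnected_Iio
    · exact Set.ordConnected_Ioo
    · exact Set.ordConnected_Ioi
  nonempty i := by
    fin_cases i
    · exact ⟨-1, by simp⟩
    · exact ⟨0, by simp⟩
    · exact ⟨1, by simp⟩
  disjoint i k h := by
    fin_cases i <;> fin_cases k <;> simp at h
    ext x
    simpa using fun h : x < 0 => h.le
  inter_nonempty i k h := by
    fin_cases i <;> fin_cases k <;> simp at h
    · exact ⟨-1 / 2, by norm_num⟩
    · exact ⟨1, by norm_num⟩
  inter_ssubset_left i k h := by
    refine (Set.inter_subset_left).ssubset_of_not_subset fun hs => ?_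
    fin_cases i <;> fin_cases k <;> simp at h
    · have := (hs (show (-5 : ℝ) ∈ Set.Iio 0 by norm_num)).2
      norm_num at this
    · have := (hs (show (0 : ℝ) ∈ Set.Ioo (-1) 3 by norm_num)).2
      norm_num at this
  inter_ssubset_right i k h := by
    refine (Set.inter_subset_right).ssubset_of_not_subset fun hs => ?_
    fin_cases i <;> fin_cases k <;> simp at h
    · have := (hs (show (1 : ℝ) ∈ Set.Ioo (-1) 3 by norm_num)).1
      norm_num at this
    · have := (hs (show (5 : ℝ) ∈ Set.Ioi 0 by norm_num)).1
      norm_num at this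

theorem isChainGroup_codedChainGroup (A : Set ℕ) : IsChainGroup 3 (codedChainGroup A) := by
  refine ⟨chainGenerators A, ⟨by norm_num, _, isChainOfIntervals_chain, ?_, ?_, ?_⟩, rfl, ?_⟩
  · intro i k h
    fin_cases i <;> fin_cases k <;> simp at h
    · exact leftEndpoint_lt (x := -2) (y := -1) (by norm_num) (by norm_num) fun z hz => hz.1.le
    · exact leftEndpoint_lt (x := -1 / 2) (y := 0) (by norm_num) (by norm_num)
        fun z hz => le_of_lt hz
  · intro i
    fin_cases i
    · exact lineSupport_chainLeft
    · exact lineSupport_chainMid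
    · exact lineSupport_chainRight A
  · intro i t
    fin_cases i
    · exact le_chainLeft t
    · exact le_chainMid t
    · exact le_chainRight A t
  · intro i k h
    fin_cases i <;> fin_cases k <;> simp at h
    · exact isFastPair_left_mid.nonempty_mulEquiv
    · exact (isFastPair_mid_right A).nonempty_mulEquiv

/-! ## Dynamics of the coded three-chain groups -/

namespace codedChainGroup

variable (A : Set ℕ)

theorem left_mem : chainLeft ∈ codedChainGroup A := Subgroup.subset_closure ⟨0, rfl⟩

theorem mid_mem : chainMid ∈ codedChainGroup A := Subgroup.subset_closure ⟨1, rfl⟩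

theorem right_mem : chainRight A ∈ codedChainGroup A := Subgroup.subset_closure ⟨2, rfl⟩

theorem exists_lt_apply (x y : ℝ) : ∃ h ∈ codedChainGroup A, y < h x := by
  obtain ⟨l, hl⟩ := exists_lt_pow_apply (f := chainLeft) (x := x) (y := -1 / 2)
    fun t _ ht => lt_chainLeft (by linarith)
  obtain ⟨m, hm⟩ := exists_lt_pow_apply (f := chainMid) (x := (chainLeft ^ l) x) (y := 1)
    fun t ht ht' => lt_chainMid (by linarith) (by linarith)
  obtain ⟨r, hr⟩ := exists_lt_pow_apply (f := chainRight A)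
    (x := (chainMid ^ m) ((chainLeft ^ l) x)) (y := y) fun t ht _ => lt_chainRight A (by linarith)
  exact ⟨chainRight A ^ r * (chainMid ^ m * chainLeft ^ l),
    mul_mem (pow_mem (right_mem A) _) (mul_mem (pow_mem (mid_mem A) _) (pow_mem (left_mem A) _)),
    hr⟩

theorem exists_apply_lt (x y : ℝ) : ∃ h ∈ codedChainGroup A, h x < y := by
  obtain ⟨h, hh, hlt⟩ := exists_lt_apply A y x
  refine ⟨h⁻¹, inv_mem hh, ?_⟩
  have := (h⁻¹).strictMono hlt
  rwa [RelIso.inv_apply_self] at this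

theorem exists_abs_apply_le (g : ℝ ≃o ℝ) (R : ℝ) : ∃ R', ∀ x, |x| ≤ R → |g x| ≤ R' := by
  refine ⟨max |g R| |g (-R)|, fun x hx => ?_⟩
  obtain ⟨h1, h2⟩ := abs_le.1 hx
  have h3 := g.monotone h1
  have h4 := g.monotone h2
  rw [abs_le]
  constructor
  · have := neg_abs_le (g (-R))
    have := le_max_right |g R| |g (-R)|
    linarith
  · have := le_abs_self (g R)
    have := le_max_left |g R| |g (-R)|
    linarith

/-- On a bounded set every element of the group agrees with an element of the derived subgroup. -/
theorem exists_mem_commutator_eqOn {g : ℝ ≃o ℝ} (hg : g ∈ codedChainGroup A) :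
    ∀ R : ℝ, ∃ g' ∈ ⁅codedChainGroup A, codedChainGroup A⁆, ∀ x, |x| ≤ R → g' x = g x := by
  have hgen : ∀ s ∈ codedChainGroup A, ∀ h ∈ codedChainGroup A, ∀ R : ℝ,
      (∀ x, |x| ≤ R → s (h x) = h x) →
      ∃ g' ∈ ⁅codedChainGroup A, codedChainGroup A⁆, ∀ x, |x| ≤ R → g' x = s x := by
    intro s hs h hh R hx
    -- ⁅s, h⁻¹⁆ = s · h⁻¹s⁻¹h, and the second factor is trivial wherever s fixes h x. Every
    -- generator fixes a half-line, into which some h pushes [-R, R].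
    refine ⟨⁅s, h⁻¹⁆, Subgroup.commutator_mem_commutator hs (inv_mem hh), fun x hxR => ?_⟩
    have h1 : (s⁻¹ : ℝ ≃o ℝ) (h x) = h x := by
      conv_lhs => rw [← hx x hxR]
      rw [RelIso.inv_apply_self]
    rw [commutatorElement_def, inv_inv]
    simp only [RelIso.mul_apply]
    rw [h1, RelIso.inv_apply_self]
  induction hg using Subgroup.closure_induction with
  | mem s hs =>
    intro R
    obtain ⟨i, rfl⟩ := hs
    fin_cases i
    · obtain ⟨h, hh, hlt⟩ := exists_lt_apply A (-R) 0
      refine hgen _ (left_mem A) h hh R fun x hx => chainLeft_of_nonneg ?_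
      exact hlt.le.trans (h.monotone (abs_le.1 hx).1)
    · obtain ⟨h, hh, hlt⟩ := exists_lt_apply A (-R) 3
      refine hgen _ (mid_mem A) h hh R fun x hx => chainMid_of_ge ?_
      exact hlt.le.trans (h.monotone (abs_le.1 hx).1)
    · obtain ⟨h, hh, hlt⟩ := exists_apply_lt A R 0
      refine hgen _ (right_mem A) h hh R fun x hx => chainRight_of_nonpos A ?_
      exact (h.monotone (abs_le.1 hx).2).trans hlt.le
  | one => exact fun R => ⟨1, one_mem _, fun _ _ => rfl⟩
  | mul u v _ _ hu hv =>
    intro R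
    obtain ⟨R', hR'⟩ := exists_abs_apply_le v R
    obtain ⟨u', hu', h1⟩ := hu R'
    obtain ⟨v', hv', h2⟩ := hv R
    refine ⟨u' * v', mul_mem hu' hv', fun x hx => ?_⟩
    rw [RelIso.mul_apply, RelIso.mul_apply, h2 x hx, h1 _ (hR' x hx)]
  | inv u _ hu =>
    intro R
    obtain ⟨R', hR'⟩ := exists_abs_apply_le u⁻¹ R
    obtain ⟨u', hu', h1⟩ := hu R'
    refine ⟨u'⁻¹, inv_mem hu', fun x hx => ?_⟩
    have h2 := h1 _ (hR' x hx)
    rw [RelIso.apply_inv_self] at h2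
    conv_lhs => rw [← h2]
    rw [RelIso.inv_apply_self]

theorem chainMid_inv_apply {y : ℝ} (h : -1 ≤ y) (h' : y ≤ 1) :
    (chainMid⁻¹ : ℝ ≃o ℝ) y = (y - 1) / 2 := by
  have h1 : chainMid ((y - 1) / 2) = y := by
    rw [chainMid_eq_double (by linarith) (by linarith)]
    ring
  conv_lhs => rw [← h1]
  rw [RelIso.inv_apply_self]

/-- The orbit of `-1` is dense in `[-1, 0]`. -/
theorem exists_abs_apply_neg_one_sub_le (n : ℕ) :
    ∀ x : ℝ, -1 ≤ x → x ≤ 0 → ∃ g ∈ codedChainGroup A,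
      -1 ≤ g (-1) ∧ g (-1) ≤ 0 ∧ |g (-1) - x| ≤ (1 / 2 : ℝ) ^ n := by
  induction n with
  | zero =>
    intro x hx hx'
    refine ⟨1, one_mem _, ?_, ?_, ?_⟩
    · exact le_rfl
    · rw [RelIso.one_apply]; norm_num
    · rw [RelIso.one_apply, abs_le]
      constructor <;> norm_num <;> linarith
  | succ n ih =>
    intro x hx hx'
    -- `chainLeft` and `chainMid⁻¹` act on [-1, 0] as contractions of ratio 1/2 onto [-1/2, 0] and
    -- [-1, -1/2]. These images cover [-1, 0], so each step halves the error.
    rcases le_total (-1 / 2) x with h | h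
    · obtain ⟨g, hg, h1, h2, h3⟩ := ih (2 * x) (by linarith) (by linarith)
      refine ⟨chainLeft * g, mul_mem (left_mem A) hg, ?_⟩
      rw [RelIso.mul_apply, chainLeft_eq_half (by linarith) h2]
      refine ⟨by linarith, by linarith, ?_⟩
      rw [abs_le] at h3 ⊢
      rw [pow_succ]
      constructor <;> linarith [h3.1, h3.2]
    · obtain ⟨g, hg, h1, h2, h3⟩ := ih (2 * x + 1) (by linarith) (by linarith)
      refine ⟨chainMid⁻¹ * g, mul_mem (inv_mem (mid_mem A)) hg, ?_⟩
      rw [RelIso.mul_apply, chainMid_inv_apply h1 (by linarith)]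
      refine ⟨by linarith, by linarith, ?_⟩
      rw [abs_le] at h3 ⊢
      rw [pow_succ]
      constructor <;> linarith [h3.1, h3.2]

/-- Once x has been moved below -1, the first power of `chainLeft` to carry it past -1 cannot
overshoot 0, since `chainLeft` sends -1 to -1/2. -/
theorem exists_apply_mem_Icc (x : ℝ) :
    ∃ g ∈ codedChainGroup A, -1 ≤ g x ∧ g x ≤ 0 := by
  obtain ⟨h, hh, hx⟩ := exists_apply_lt A x (-1)
  have hex : ∃ n : ℕ, -1 < (chainLeft ^ n) (h x) :=
    exists_lt_pow_apply fun t _ ht => lt_chainLeft (by linarith)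
  classical
  refine ⟨chainLeft ^ Nat.find hex * h, mul_mem (pow_mem (left_mem A) _) hh,
    (Nat.find_spec hex).le, ?_⟩
  rw [RelIso.mul_apply]
  rcases hn : Nat.find hex with _ | n
  · rw [pow_zero, RelIso.one_apply]
    linarith
  · have h1 : (chainLeft ^ n) (h x) ≤ -1 := not_lt.1 (Nat.find_min hex (by omega))
    have h2 := chainLeft.monotone h1
    rw [chainLeft_eq_half (x := -1) (by norm_num) (by norm_num)] at h2
    rw [pow_succ', RelIso.mul_apply]
    linarith

theorem exists_apply_neg_one_mem {u v : ℝ} (huv : u < v) :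
    ∃ h ∈ codedChainGroup A, u < h (-1) ∧ h (-1) < v := by
  obtain ⟨x, hux, hxv⟩ := exists_between huv
  obtain ⟨g, hg, h1, h2⟩ := exists_apply_mem_Icc A x
  have h3 := g.strictMono hux
  have h4 := g.strictMono hxv
  obtain ⟨n, hn⟩ := exists_pow_lt_of_lt_one
    (lt_min (sub_pos.2 h3) (sub_pos.2 h4)) (show (1 / 2 : ℝ) < 1 by norm_num)
  obtain ⟨h, hh, -, -, h5⟩ := exists_abs_apply_neg_one_sub_le A n (g x) h1 h2
  obtain ⟨h6, h7⟩ := abs_le.1 h5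
  obtain ⟨h8, h9⟩ := lt_min_iff.1 hn
  refine ⟨g⁻¹ * h, mul_mem (inv_mem hg) hh, ?_, ?_⟩
  · have := (g⁻¹).strictMono (show g u < h (-1) by linarith)
    rwa [RelIso.inv_apply_self] at this
  · have := (g⁻¹).strictMono (show h (-1) < g v by linarith)
    rwa [RelIso.inv_apply_self] at this

/-- Some h sends a short interval (-1, w) into (u, v). To bring [-R, R] into (-1, w): powers of
`chainLeft` lift it above -1/2, negative powers of `chainRight A` pull its top below 1 while fixing
-1/2, and negative powers of `chainMid` pull 1 below w while fixing -1. -/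
theorem exists_compress (R : ℝ) {u v : ℝ} (huv : u < v) :
    ∃ g ∈ codedChainGroup A, u < g (-R) ∧ g R < v := by
  obtain ⟨h, hh, hu, hv⟩ := exists_apply_neg_one_mem A huv
  obtain ⟨w, hw, hwv⟩ : ∃ w, -1 < w ∧ h w < v := by
    have h3 : ∀ᶠ w in 𝓝[>] (-1), h w < v :=
      (h.continuous.continuousAt.eventually (gt_mem_nhds hv)).filter_mono nhdsWithin_le_nhds
    obtain ⟨w, h4, h5⟩ := (h3.and self_mem_nhdsWithin).exists
    exact ⟨w, h5, h4⟩
  obtain ⟨l, hl⟩ := exists_lt_pow_apply (f := chainLeft) (x := -R) (y := -1 / 2)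
    fun t _ ht => lt_chainLeft (by linarith)
  obtain ⟨r, hr⟩ := exists_lt_pow_apply (f := chainRight A) (x := 1) (y := (chainLeft ^ l) R)
    fun t ht _ => lt_chainRight A (by linarith)
  obtain ⟨m, hm⟩ := exists_lt_pow_apply (f := chainMid) (x := w) (y := 1)
    fun t ht ht' => lt_chainMid (by linarith) (by linarith)
  have fix : ∀ (f : ℝ ≃o ℝ) (t : ℝ), f t = t → ∀ n : ℕ, (f ^ n)⁻¹ t = t := by
    intro f t ht n
    have : (f ^ n) t = t := by
      induction n with
      | zero => rfl
      | succ n ih => rw [pow_succ, RelIso.mul_apply, ht, ih]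
    conv_lhs => rw [← this]
    rw [RelIso.inv_apply_self]
  refine ⟨h * ((chainMid ^ m)⁻¹ * ((chainRight A ^ r)⁻¹ * chainLeft ^ l)),
    mul_mem hh (mul_mem (inv_mem (pow_mem (mid_mem A) _))
      (mul_mem (inv_mem (pow_mem (right_mem A) _)) (pow_mem (left_mem A) _))), ?_, ?_⟩
  · simp only [RelIso.mul_apply]
    refine hu.trans (h.strictMono ?_)
    have h1 := ((chainRight A ^ r)⁻¹).strictMono hl
    rw [fix _ _ (chainRight_of_nonpos A (by norm_num))] at h1
    have h2 := ((chainMid ^ m)⁻¹).strictMono ((show (-1 : ℝ) < -1 / 2 by norm_num).trans h1)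
    rwa [fix _ _ (chainMid_of_le le_rfl)] at h2
  · simp only [RelIso.mul_apply]
    refine lt_trans (h.strictMono ?_) hwv
    have h1 := ((chainRight A ^ r)⁻¹).strictMono hr
    rw [RelIso.inv_apply_self] at h1
    have h2 := ((chainMid ^ m)⁻¹).strictMono (h1.trans hm)
    rwa [RelIso.inv_apply_self] at h2

theorem exists_compress_commutator (R : ℝ) {u v : ℝ} (huv : u < v) :
    ∃ g ∈ ⁅codedChainGroup A, codedChainGroup A⁆, u < g (-R) ∧ g R < v := by
  obtain ⟨g, hg, h1, h2⟩ := exists_compress A R huv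
  obtain ⟨g', hg', h3⟩ := exists_mem_commutator_eqOn A hg |R|
  refine ⟨g', hg', ?_, ?_⟩
  · rwa [h3 _ (abs_neg R).le]
  · rwa [h3 _ le_rfl]

theorem chainMid_mem_compactHomeo : chainMid ∈ compactHomeo := by
  refine ⟨3, fun x hx => ?_⟩
  rcases le_abs.1 hx with h | h
  · exact chainMid_of_ge h
  · exact chainMid_of_le (by linarith)

theorem commute_left_right : Commute chainLeft (chainRight A) :=
  commute_of_disjoint_moved fun x => (le_total 0 x).imp chainLeft_of_nonneg (chainRight_of_nonpos A)

/-- The outer generators commute, so only the commutators of the two consecutive pairs matter.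
Compact support and perfectness both reduce to these. -/
theorem commutator_le_of_mem {N : Subgroup (ℝ ≃o ℝ)}
    (hN : ∀ l ∈ codedChainGroup A, ∀ y ∈ N, l * y * l⁻¹ ∈ N) (h1 : ⁅chainLeft, chainMid⁆ ∈ N)
    (h2 : ⁅chainMid, chainRight A⁆ ∈ N) : ⁅codedChainGroup A, codedChainGroup A⁆ ≤ N := by
  have h1' := inv_mem h1
  have h2' := inv_mem h2
  rw [commutatorElement_inv] at h1' h2'
  have h3 : ⁅chainLeft, chainRight A⁆ ∈ N := by
    rw [(commute_left_right A).commutator_eq]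
    exact one_mem _
  have h3' := inv_mem h3
  rw [commutatorElement_inv] at h3'
  refine commutator_closure_le hN ?_
  rintro _ ⟨i, rfl⟩ _ ⟨k, rfl⟩
  have h0 : ∀ g : ℝ ≃o ℝ, ⁅g, g⁆ ∈ N := fun g => by
    rw [commutatorElement_self]
    exact one_mem _
  fin_cases i <;> fin_cases k
  · exact h0 _
  · exact h1
  · exact h3
  · exact h1'
  · exact h0 _
  · exact h2
  · exact h3'
  · exact h2'
  · exact h0 _

theorem commutator_le_compactHomeo : ⁅codedChainGroup A, codedChainGroup A⁆ ≤ compactHomeo := by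
  refine commutator_le_of_mem A (fun l _ y hy => conj_mem_compactHomeo l hy) ?_ ?_
  · rw [commutatorElement_def]
    exact mul_mem (conj_mem_compactHomeo _ chainMid_mem_compactHomeo)
      (inv_mem chainMid_mem_compactHomeo)
  · rw [commutatorElement_def, mul_assoc, mul_assoc, ← mul_assoc (chainRight A)]
    exact mul_mem chainMid_mem_compactHomeo
      (conj_mem_compactHomeo _ (inv_mem chainMid_mem_compactHomeo))

theorem commutator_perfect : ⁅codedChainGroup A, codedChainGroup A⁆ ≤
    ⁅⁅codedChainGroup A, codedChainGroup A⁆, ⁅codedChainGroup A, codedChainGroup A⁆⁆ :=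
  commutator_le_of_mem A (conj_mem_secondDerived _)
    (isFastPair_left_mid.commutator_mem (left_mem A) (mid_mem A))
    ((isFastPair_mid_right A).commutator_mem (mid_mem A) (right_mem A))

theorem commutator_ne_bot : ⁅codedChainGroup A, codedChainGroup A⁆ ≠ ⊥ := by
  intro h
  have h1 := Subgroup.commutator_mem_commutator (left_mem A) (mid_mem A)
  rw [h, Subgroup.mem_bot, commutatorElement_eq_one_iff_mul_comm] at h1
  have h2 := DFunLike.congr_fun h1 (-1)
  norm_num [RelIso.mul_apply, chainLeft_apply, chainMid_apply] at h2

theorem isSimpleGroup_commutator :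
    IsSimpleGroup (⁅codedChainGroup A, codedChainGroup A⁆ : Subgroup (ℝ ≃o ℝ)) :=
  isSimpleGroup_of_compressible (commutator_ne_bot A) (commutator_le_compactHomeo A)
    (commutator_perfect A) fun R _ _ h => exists_compress_commutator A R h

theorem countable : Countable (codedChainGroup A) := by
  have h : codedChainGroup A = (FreeGroup.lift (chainGenerators A)).range :=
    FreeGroup.range_lift_eq_closure.symm
  rw [h]
  exact (MonoidHom.rangeRestrict_surjective _).countable

theorem countable_commutator :
    Countable (⁅codedChainGroup A, codedChainGroup A⁆ : Subgroup (ℝ ≃o ℝ)) := by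
  have := countable A
  have h : ⁅codedChainGroup A, codedChainGroup A⁆ ≤ codedChainGroup A :=
    Subgroup.commutator_le.2 fun g hg g' hg' =>
      mul_mem (mul_mem (mul_mem hg hg') (inv_mem hg)) (inv_mem hg')
  exact (Subgroup.inclusion_injective h).countable

end codedChainGroup

/-! ## The code is an invariant of the derived subgroup -/

namespace codedChainGroup

variable (A : Set ℕ)

/-- A conjugate of `chainMid` that doubles near `0`. -/
noncomputable def doubling : ℝ ≃o ℝ :=
  chainMid * chainLeft * chainMid * (chainMid * chainLeft)⁻¹

theorem doubling_mem : doubling ∈ codedChainGroup A :=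
  mul_mem (mul_mem (mul_mem (mid_mem A) (left_mem A)) (mid_mem A))
    (inv_mem (mul_mem (mid_mem A) (left_mem A)))

/-- `chainMid` expands by 2 from its fixed point -1, and `chainMid * chainLeft` is translation by 1
near there, carrying -1 to 0. -/
theorem doubling_apply {x : ℝ} (h : 0 ≤ x) (h' : x ≤ 1 / 2) : doubling x = 2 * x := by
  have h1 : (chainMid * chainLeft) (x - 1) = x := by
    rw [RelIso.mul_apply, chainLeft_eq_half (by linarith) (by linarith),
      chainMid_eq_double (by linarith) (by linarith)]
    ring
  have h2 : ((chainMid * chainLeft)⁻¹ : ℝ ≃o ℝ) x = x - 1 := by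
    conv_lhs => rw [← h1]
    rw [RelIso.inv_apply_self]
  rw [doubling, RelIso.mul_apply, h2, RelIso.mul_apply, RelIso.mul_apply,
    chainMid_eq_double (x := x - 1) (by linarith) (by linarith),
    chainLeft_eq_half (x := 2 * (x - 1) + 1) (by linarith) (by linarith),
    chainMid_eq_double (x := (2 * (x - 1) + 1) / 2) (by linarith) (by linarith)]
  ring

theorem codeBump_half_le (x : ℝ) (h' : x ≤ 1 / 2) : codeBump A x ≤ 1 / 2 := by
  have h1 := (codeBump A).monotone h'
  have h2 := codeBump_of_notMem (pow_half_notMem_dyadicGaps A 0)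
  rw [zero_add, pow_one] at h2
  rwa [h2] at h1

/-- `doubling` cancels the dilation in `chainRight A`, so the group contains an element that acts on
[0, 1/2] as the bare coding bump. -/
theorem doubling_inv_mul_right_apply {x : ℝ} (h : 0 ≤ x) (h' : x ≤ 1 / 2) :
    (doubling⁻¹ * chainRight A) x = codeBump A x := by
  have h1 := codeBump_half_le A x h'
  have h2 := h.trans (le_codeBump A x)
  rw [RelIso.mul_apply, chainRight, RelIso.mul_apply, rightDilation_eq_double h2 h1,
    ← doubling_apply h2 h1, RelIso.inv_apply_self]

theorem pow_apply_of_doubling {T : ℝ ≃o ℝ} (hT : ∀ x, 0 ≤ x → x ≤ 1 / 2 → T x = 2 * x) (n : ℕ) :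
    ∀ y, 0 ≤ y → y ≤ 1 → (T ^ n) ((1 / 2) ^ n * y) = y := by
  induction n with
  | zero => intro y _ _; simp
  | succ n ih =>
    intro y hy hy'
    have h1 : (1 / 2 : ℝ) ^ n ≤ 1 := pow_le_one₀ (by norm_num) (by norm_num)
    have h2 : (1 / 2 : ℝ) ^ n * y ≤ 1 := mul_le_one₀ h1 hy hy'
    have h3 : 0 ≤ (1 / 2 : ℝ) ^ n * y := by positivity
    rw [pow_succ, RelIso.mul_apply, hT _ (by rw [pow_succ]; linarith) (by rw [pow_succ]; linarith)]
    rw [show 2 * ((1 / 2 : ℝ) ^ (n + 1) * y) = (1 / 2) ^ n * y by rw [pow_succ]; ring]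
    exact ih y hy hy'

/-- T^(n+1) magnifies the n-th gap (2⁻ⁿ⁻², 2⁻ⁿ⁻¹) to (1/2, 1), so the conjugate displays there
whether that gap is moved. -/
theorem conj_pow_apply {T κ : ℝ ≃o ℝ} (hT : ∀ x, 0 ≤ x → x ≤ 1 / 2 → T x = 2 * x)
    (hκ : ∀ x, 0 ≤ x → x ≤ 1 / 2 → κ x = codeBump A x) (n : ℕ) {y : ℝ} (hy : 1 / 2 ≤ y)
    (hy' : y ≤ 1) :
    (n ∉ A → (T ^ (n + 1) * κ * (T ^ (n + 1))⁻¹) y = y) ∧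
      (n ∈ A → 1 / 2 < y → y < 1 → y < (T ^ (n + 1) * κ * (T ^ (n + 1))⁻¹) y) := by
  have hpos : (0 : ℝ) < (1 / 2) ^ (n + 1) := by positivity
  set z : ℝ := (1 / 2) ^ (n + 1) * y with hz
  have h0 : (T ^ (n + 1)) z = y := pow_apply_of_doubling hT (n + 1) y (by linarith) hy'
  have h1 : ((T ^ (n + 1))⁻¹ : ℝ ≃o ℝ) y = z := by
    conv_lhs => rw [← h0]
    rw [RelIso.inv_apply_self]
  have hz1 : (1 / 2 : ℝ) ^ (n + 2) ≤ z := by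
    rw [hz, pow_succ]
    exact mul_le_mul_of_nonneg_left hy hpos.le
  have hz2 : z ≤ (1 / 2 : ℝ) ^ (n + 1) := by
    rw [hz]
    exact mul_le_of_le_one_right hpos.le hy'
  have hz3 : z ≤ 1 / 2 := hz2.trans (by
    simpa using pow_le_pow_of_le_one (a := (1 / 2 : ℝ)) (by norm_num) (by norm_num)
      (show 1 ≤ n + 1 by omega))
  have hz0 : 0 ≤ z := le_trans (by positivity) hz1
  rw [RelIso.mul_apply, RelIso.mul_apply, h1, hκ z hz0 hz3]
  constructor
  · intro hn
    rw [codeBump_of_notMem fun h => hn (mem_of_mem_dyadicGaps h hz1 hz2).1, h0]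
  · intro hn h2 h3
    conv_lhs => rw [← h0]
    refine (T ^ (n + 1)).strictMono (lt_codeBump ?_)
    simp only [dyadicGaps, Set.mem_iUnion]
    refine ⟨n, hn, ?_, ?_⟩
    · rw [hz, pow_succ]
      exact mul_lt_mul_of_pos_left h2 hpos
    · rw [hz]
      exact mul_lt_of_lt_one_right hpos h3

/-- The set coded by a triple of group elements. -/
def commutationCode {G : Type*} [Group G] (p : G × G × G) : Set ℕ :=
  {n | ¬ Commute (p.1 ^ (n + 1) * p.2.1 * (p.1 ^ (n + 1))⁻¹) p.2.2}

theorem commutationCode_map {G H : Type*} [Group G] [Group H] (φ : G →* H)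
    (hφ : Function.Injective φ) (p : G × G × G) :
    commutationCode (φ p.1, φ p.2.1, φ p.2.2) = commutationCode p := by
  ext n
  simp only [commutationCode, Set.mem_ofPred_eq, ← map_pow, ← map_inv, ← map_mul]
  exact not_congr ⟨fun h => hφ (by simpa using h.eq), fun h => h.map φ⟩

theorem exists_commutationCode_eq :
    ∃ p : (⁅codedChainGroup A, codedChainGroup A⁆ : Subgroup (ℝ ≃o ℝ)) ×
      (⁅codedChainGroup A, codedChainGroup A⁆ : Subgroup (ℝ ≃o ℝ)) ×
      (⁅codedChainGroup A, codedChainGroup A⁆ : Subgroup (ℝ ≃o ℝ)), commutationCode p = A := by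
  obtain ⟨T, hTm, hT⟩ := exists_mem_commutator_eqOn A (doubling_mem A) 1
  obtain ⟨κ, hκm, hκ⟩ := exists_mem_commutator_eqOn A
    (mul_mem (inv_mem (doubling_mem A)) (right_mem A)) 1
  have habs : ∀ x : ℝ, 0 ≤ x → x ≤ 1 / 2 → |x| ≤ 1 := fun x h h' =>
    abs_le.2 ⟨by linarith, by linarith⟩
  have hT' : ∀ x, 0 ≤ x → x ≤ 1 / 2 → T x = 2 * x := fun x h h' => by
    rw [hT x (habs x h h'), doubling_apply h h']
  have hκ' : ∀ x, 0 ≤ x → x ≤ 1 / 2 → κ x = codeBump A x := fun x h h' => by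
    rw [hκ x (habs x h h'), doubling_inv_mul_right_apply A h h']
  obtain ⟨c, hcm, hc⟩ := (Subgroup.ne_bot_iff_exists_ne_one.1 (commutator_ne_bot A)).elim
    fun a ha => (⟨a.1, a.2, fun h => ha (Subtype.ext h)⟩ :
      ∃ c ∈ ⁅codedChainGroup A, codedChainGroup A⁆, c ≠ 1)
  obtain ⟨R, hR⟩ := commutator_le_compactHomeo A hcm
  -- Conjugation by g yields a nontrivial a supported inside (1/2, 1), the window in which all the
  -- magnified gaps are compared.
  obtain ⟨g, hg, hgu, hgv⟩ := exists_compress_commutator A R (show (1 / 2 : ℝ) < 1 by norm_num)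
  set a : ℝ ≃o ℝ := g * c * g⁻¹ with ha
  have ham : a ∈ ⁅codedChainGroup A, codedChainGroup A⁆ :=
    mul_mem (mul_mem hg hcm) (inv_mem hg)
  have hax : ∀ x, x ≤ g (-R) ∨ g R ≤ x → a x = x := fun x hx =>
    conj_apply_eq_of_notMem hR le_rfl le_rfl hx
  have ha1 : ∃ z, a z ≠ z := by
    by_contra! h
    refine hc ?_
    have h1 : a = 1 := RelIso.ext h
    rwa [ha, conj_eq_one_iff] at h1
  refine ⟨(⟨T, hTm⟩, ⟨κ, hκm⟩, ⟨a, ham⟩), ?_⟩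
  rw [← commutationCode_map (Subgroup.subtype _) (Subgroup.subtype_injective _)]
  ext n
  simp only [commutationCode, Set.mem_ofPred_eq, Subgroup.subtype_apply]
  set w : ℝ ≃o ℝ := T ^ (n + 1) * κ * (T ^ (n + 1))⁻¹ with hw
  have hwy := fun (y : ℝ) (h1 : 1 / 2 ≤ y) (h2 : y ≤ 1) => conj_pow_apply A hT' hκ' n h1 h2
  constructor
  · contrapose!
    intro hn
    refine commute_of_disjoint_moved fun x => ?_
    by_cases hx : x ≤ g (-R) ∨ g R ≤ x
    · exact Or.inr (hax x hx)
    · push Not at hx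
      exact Or.inl ((hwy x (by linarith) (by linarith)).1 hn)
  · intro hn hcomm
    obtain ⟨z, hz⟩ := ha1
    have hz1 : g (-R) < z ∧ z < g R := by
      by_contra h
      refine hz (hax z ?_)
      by_contra! h'
      exact h h'
    -- For n in `A`, w pushes every point of (1/2, 1) upwards, so a power of w carries z out of the
    -- support of a. If w commuted with a, then a would fix z.
    obtain ⟨m, hm⟩ := exists_lt_pow_apply (f := w) (x := z) (y := g R) fun t h1 h2 =>
      (hwy t (by linarith) (by linarith)).2 hn (by linarith) (by linarith)
    have h1 := hax _ (Or.inr hm.le)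
    rw [← RelIso.mul_apply, ← (hcomm.pow_left m).eq, RelIso.mul_apply] at h1
    exact hz ((w ^ m).injective h1)

end codedChainGroup

/-! ## Homeomorphisms of the line acting on a one-manifold -/

/-- The extension by the identity of the action of a homeomorphism of the line on `(-1, 1)`. -/
noncomputable def extendFun (h : ℝ ≃o ℝ) (x : ℝ) : ℝ :=
  open Classical in
  if hx : x ∈ Set.Ioo (-1 : ℝ) 1 then
    orderIsoIooNegOneOne ℝ (h ((orderIsoIooNegOneOne ℝ).symm ⟨x, hx⟩)) else x

theorem extendFun_of_mem (h : ℝ ≃o ℝ) {x : ℝ} (hx : x ∈ Set.Ioo (-1 : ℝ) 1) :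
    extendFun h x = orderIsoIooNegOneOne ℝ (h ((orderIsoIooNegOneOne ℝ).symm ⟨x, hx⟩)) :=
  dif_pos hx

theorem extendFun_of_notMem (h : ℝ ≃o ℝ) {x : ℝ} (hx : x ∉ Set.Ioo (-1 : ℝ) 1) :
    extendFun h x = x := dif_neg hx

theorem extendFun_mem (h : ℝ ≃o ℝ) {x : ℝ} (hx : x ∈ Set.Ioo (-1 : ℝ) 1) :
    extendFun h x ∈ Set.Ioo (-1 : ℝ) 1 := by
  rw [extendFun_of_mem h hx]
  exact Subtype.mem _

theorem extendFun_orderIso (h : ℝ ≃o ℝ) (x : ℝ) :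
    extendFun h (orderIsoIooNegOneOne ℝ x) = orderIsoIooNegOneOne ℝ (h x) := by
  rw [extendFun_of_mem h (Subtype.mem _), Subtype.coe_eta, OrderIso.symm_apply_apply]

theorem extendFun_one (x : ℝ) : extendFun 1 x = x := by
  by_cases hx : x ∈ Set.Ioo (-1 : ℝ) 1
  · rw [extendFun_of_mem 1 hx, RelIso.one_apply, OrderIso.apply_symm_apply]
  · exact extendFun_of_notMem 1 hx

theorem extendFun_mul (g h : ℝ ≃o ℝ) (x : ℝ) :
    extendFun (g * h) x = extendFun g (extendFun h x) := by
  by_cases hx : x ∈ Set.Ioo (-1 : ℝ) 1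
  · rw [extendFun_of_mem _ hx, extendFun_of_mem h hx, extendFun_orderIso, RelIso.mul_apply]
  · rw [extendFun_of_notMem _ hx, extendFun_of_notMem h hx, extendFun_of_notMem g hx]

theorem extendFun_monotone (h : ℝ ≃o ℝ) : Monotone (extendFun h) := by
  intro x y hxy
  by_cases hx : x ∈ Set.Ioo (-1 : ℝ) 1
  · by_cases hy : y ∈ Set.Ioo (-1 : ℝ) 1
    · rw [extendFun_of_mem h hx, extendFun_of_mem h hy, Subtype.coe_le_coe,
        OrderIso.le_iff_le, OrderIso.le_iff_le, OrderIso.le_iff_le]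
      exact hxy
    · have h1 := extendFun_mem h hx
      rw [extendFun_of_notMem h hy]
      by_contra! h2
      exact hy ⟨hx.1.trans_le hxy, h2.trans h1.2⟩
  · rw [extendFun_of_notMem h hx]
    by_cases hy : y ∈ Set.Ioo (-1 : ℝ) 1
    · have h1 := extendFun_mem h hy
      by_contra! h2
      exact hx ⟨h1.1.trans h2, hxy.trans_lt hy.2⟩
    · rwa [extendFun_of_notMem h hy]

theorem extendFun_inv_apply (h : ℝ ≃o ℝ) (x : ℝ) : extendFun h⁻¹ (extendFun h x) = x := by
  rw [← extendFun_mul, inv_mul_cancel, extendFun_one]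

theorem extendFun_strictMono (h : ℝ ≃o ℝ) : StrictMono (extendFun h) :=
  (extendFun_monotone h).strictMono_of_injective
    (Function.LeftInverse.injective (extendFun_inv_apply h))

theorem extendFun_continuous (h : ℝ ≃o ℝ) : Continuous (extendFun h) :=
  (extendFun_monotone h).continuous_of_surjective fun x =>
    ⟨extendFun h⁻¹ x, by simpa using extendFun_inv_apply h⁻¹ x⟩

theorem extendFun_mem_Ioo (h : ℝ ≃o ℝ) {x : ℝ} (hx : x ∈ Set.Ioo (-2 : ℝ) 2) :
    extendFun h x ∈ Set.Ioo (-2 : ℝ) 2 := by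
  by_cases hx' : x ∈ Set.Ioo (-1 : ℝ) 1
  · have := extendFun_mem h hx'
    exact ⟨by linarith [this.1], by linarith [this.2]⟩
  · rwa [extendFun_of_notMem h hx']

/-! ### Charts of a one-manifold and the transported action. -/

section Chart

variable {M : Type*} [TopologicalSpace M]

/-- The positive half-line, as a chart of `[0, ∞)`. -/
noncomputable def positiveChart : OpenPartialHomeomorph (Set.Ici (0 : ℝ)) ℝ where
  toFun := Subtype.val
  invFun t := ⟨max 0 t, le_max_left 0 t⟩
  source := {t | 0 < (t : ℝ)}
  target := Set.Ioi 0
  map_source' _ h := h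
  map_target' t h := lt_of_lt_of_le h (le_max_right 0 t)
  left_inv' t _ := Subtype.ext (max_eq_right t.2)
  right_inv' t h := max_eq_right (le_of_lt h)
  open_source := isOpen_lt continuous_const continuous_subtype_val
  open_target := isOpen_Ioi
  continuousOn_toFun := continuous_subtype_val.continuousOn
  continuousOn_invFun := by
    refine Continuous.continuousOn ?_
    exact (continuous_const.max continuous_id).subtype_mk _

theorem IsOneManifold.exists_chart_Ioo [Nonempty M] (hM : IsOneManifold M) :
    ∃ e : OpenPartialHomeomorph M ℝ, e.target = Set.Ioo (-2) 2 := by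
  obtain ⟨x⟩ := ‹Nonempty M›
  obtain ⟨e₀, hx⟩ := hM.exists_chart x
  obtain ⟨O, hO, hOe⟩ := isOpen_induced_iff.1 e₀.open_target
  have hy : ((e₀ x : Set.Ici (0 : ℝ)) : ℝ) ∈ O := by
    have := e₀.map_source hx
    rwa [← hOe] at this
  -- The chosen point may lie on the boundary; a nearby coordinate is strictly positive.
  obtain ⟨y, hyO, hy0⟩ : ∃ y ∈ O, 0 < y := by
    have h1 : ∀ᶠ y in 𝓝[>] ((e₀ x : Set.Ici (0 : ℝ)) : ℝ), y ∈ O :=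
      Filter.Eventually.filter_mono nhdsWithin_le_nhds (hO.mem_nhds hy)
    obtain ⟨y, h2, h3⟩ := (h1.and self_mem_nhdsWithin).exists
    exact ⟨y, h2, lt_of_le_of_lt (e₀ x).2 h3⟩
  set e₁ := e₀.trans positiveChart with he₁
  have hye : y ∈ e₁.target := by
    rw [he₁, OpenPartialHomeomorph.trans_target]
    refine ⟨hy0, ?_⟩
    rw [Set.mem_preimage, ← hOe, Set.mem_preimage]
    change max 0 y ∈ O
    rwa [max_eq_right hy0.le]
  obtain ⟨δ, hδ, hball⟩ := Metric.isOpen_iff.1 e₁.open_target y hye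
  set φ : ℝ ≃ₜ ℝ := (Homeomorph.subRight y).trans (Homeomorph.mulRight₀ (2 / δ) (by positivity))
    with hφ
  refine ⟨(e₁.transHomeomorph φ).trans (OpenPartialHomeomorph.ofSet (Set.Ioo (-2) 2) isOpen_Ioo),
    ?_⟩
  rw [OpenPartialHomeomorph.trans_target]
  refine Set.inter_eq_left.2 fun t ht => ?_
  change φ.symm t ∈ e₁.target
  apply hball
  obtain ⟨s, rfl⟩ := φ.surjective t
  rw [Homeomorph.symm_apply_apply, Metric.mem_ball, Real.dist_eq, abs_lt]
  have h1 : φ s = (s - y) * (2 / δ) := rfl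
  have h2 : s - y = φ s * δ / 2 := by
    rw [h1]
    field_simp
  obtain ⟨h3, h4⟩ := ht
  rw [h2]
  constructor <;> nlinarith

/-- The action on a one-manifold, through a chart, of a homeomorphism of the line. -/
noncomputable def chartFun (e : OpenPartialHomeomorph M ℝ) (h : ℝ ≃o ℝ) (m : M) : M :=
  open Classical in if m ∈ e.source then e.symm (extendFun h (e m)) else m

variable {e : OpenPartialHomeomorph M ℝ}

theorem chartFun_of_mem (h : ℝ ≃o ℝ) {m : M} (hm : m ∈ e.source) :
    chartFun e h m = e.symm (extendFun h (e m)) := if_pos hm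

theorem chartFun_of_notMem (h : ℝ ≃o ℝ) {m : M} (hm : m ∉ e.source) : chartFun e h m = m :=
  if_neg hm

theorem chartFun_one (m : M) : chartFun e 1 m = m := by
  by_cases hm : m ∈ e.source
  · rw [chartFun_of_mem 1 hm, extendFun_one, e.left_inv hm]
  · exact chartFun_of_notMem 1 hm

theorem extendFun_mem_target (he : e.target = Set.Ioo (-2) 2) (h : ℝ ≃o ℝ) {m : M}
    (hm : m ∈ e.source) : extendFun h (e m) ∈ e.target := by
  have := e.map_source hm
  rw [he] at this ⊢
  exact extendFun_mem_Ioo h this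

theorem chartFun_mul (he : e.target = Set.Ioo (-2) 2) (g h : ℝ ≃o ℝ) (m : M) :
    chartFun e (g * h) m = chartFun e g (chartFun e h m) := by
  by_cases hm : m ∈ e.source
  · have h1 := extendFun_mem_target he h hm
    rw [chartFun_of_mem _ hm, chartFun_of_mem h hm, chartFun_of_mem g (e.map_target h1),
      e.right_inv h1, extendFun_mul]
  · rw [chartFun_of_notMem _ hm, chartFun_of_notMem h hm, chartFun_of_notMem g hm]

/-- All motion takes place in the preimage of [-1, 1], which is compact and hence closed as M is
Hausdorff. The margin between (-1, 1) and (-2, 2) is there for this. -/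
theorem chartFun_eventually_eq [T2Space M] (he : e.target = Set.Ioo (-2) 2) (h : ℝ ≃o ℝ) {m : M}
    (hm : m ∉ e.source) : ∀ᶠ y in 𝓝 m, chartFun e h y = y := by
  have hsub : Set.Icc (-1 : ℝ) 1 ⊆ e.target := by
    rw [he]
    exact Set.Icc_subset_Ioo (by norm_num) (by norm_num)
  have hK : IsCompact (e.symm '' Set.Icc (-1) 1) :=
    isCompact_Icc.image_of_continuousOn (e.continuousOn_symm.mono hsub)
  have hmK : m ∈ (e.symm '' Set.Icc (-1) 1)ᶜ := by
    rintro ⟨t, ht, rfl⟩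
    exact hm (e.map_target (hsub ht))
  filter_upwards [hK.isClosed.isOpen_compl.mem_nhds hmK] with y hy
  by_cases hys : y ∈ e.source
  · rw [chartFun_of_mem h hys, extendFun_of_notMem h, e.left_inv hys]
    exact fun h1 => hy ⟨e y, ⟨h1.1.le, h1.2.le⟩, e.left_inv hys⟩
  · exact chartFun_of_notMem h hys

theorem chartFun_continuous [T2Space M] (he : e.target = Set.Ioo (-2) 2) (h : ℝ ≃o ℝ) :
    Continuous (chartFun e h) := by
  rw [continuous_iff_continuousAt]
  intro m
  by_cases hm : m ∈ e.source
  · have h1 : ContinuousAt (fun y => e.symm (extendFun h (e y))) m :=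
      ContinuousAt.comp (f := fun y => extendFun h (e y))
        (e.continuousAt_symm (extendFun_mem_target he h hm))
        ((extendFun_continuous h).continuousAt.comp (e.continuousAt hm))
    refine h1.congr ?_
    filter_upwards [e.open_source.mem_nhds hm] with y hy
    rw [chartFun_of_mem h hy]
  · refine continuousAt_id.congr ?_
    filter_upwards [chartFun_eventually_eq he h hm] with y hy
    exact hy.symm

/-- The action on a one-manifold, through a chart, of the homeomorphisms of the line. -/
noncomputable def chartHomeo [T2Space M] (he : e.target = Set.Ioo (-2) 2) :
    (ℝ ≃o ℝ) →* (M ≃ₜ M) where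
  toFun h :=
    { toFun := chartFun e h
      invFun := chartFun e h⁻¹
      left_inv := fun m => by rw [← chartFun_mul he, inv_mul_cancel, chartFun_one]
      right_inv := fun m => by rw [← chartFun_mul he, mul_inv_cancel, chartFun_one]
      continuous_toFun := chartFun_continuous he h
      continuous_invFun := chartFun_continuous he h⁻¹ }
  map_one' := Homeomorph.ext fun m => chartFun_one m
  map_mul' g h := Homeomorph.ext fun m => chartFun_mul he g h m

theorem chartHomeo_injective [T2Space M] (he : e.target = Set.Ioo (-2) 2) :
    Function.Injective (chartHomeo he : (ℝ ≃o ℝ) →* (M ≃ₜ M)) := by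
  intro g h hgh
  refine RelIso.ext fun x => ?_
  have h1 : ∀ f : ℝ ≃o ℝ,
      e (chartFun e f (e.symm (orderIsoIooNegOneOne ℝ x))) = orderIsoIooNegOneOne ℝ (f x) := by
    intro f
    have hx : (orderIsoIooNegOneOne ℝ x : ℝ) ∈ e.target := by
      rw [he]
      have := (orderIsoIooNegOneOne ℝ x).2
      exact ⟨by linarith [this.1], by linarith [this.2]⟩
    have h2 := extendFun_mem_target he f (e.map_target hx)
    rw [chartFun_of_mem f (e.map_target hx), e.right_inv h2, e.right_inv hx, extendFun_orderIso]
  have h2 := DFunLike.congr_fun hgh (e.symm (orderIsoIooNegOneOne ℝ x))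
  have h3 := congrArg e h2
  change e (chartFun e g _) = e (chartFun e h _) at h3
  rw [h1, h1] at h3
  exact (orderIsoIooNegOneOne ℝ).injective (Subtype.ext h3)

/-- An orientation agrees with one of the two orders of a chart, uniformly along the chart. -/
theorem OneOrientation.chart_lt_iff (o : OneOrientation M) (he : e.target = Set.Ioo (-2) 2) :
    (∀ t ∈ e.target, ∀ᶠ p in 𝓝 (t, t), (o.lt (e.symm p.1) (e.symm p.2) ↔ p.1 < p.2)) ∨
      ∀ t ∈ e.target, ∀ᶠ p in 𝓝 (t, t), (o.lt (e.symm p.1) (e.symm p.2) ↔ p.2 < p.1) := by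
  have hopen : ∀ r : ℝ × ℝ → Prop, IsOpen {t : ℝ | ∀ᶠ p in 𝓝 (t, t), r p} := by
    intro r
    rw [isOpen_iff_mem_nhds]
    intro t ht
    have h1 : Filter.Tendsto (fun s : ℝ => (s, s)) (𝓝 t) (𝓝 (t, t)) :=
      (continuous_id.prodMk continuous_id).tendsto t
    exact h1.eventually (eventually_eventually_nhds.2 ht)
  -- P and Q are open and disjoint, and they cover the connected target because a continuous
  -- injective function on an interval is strictly monotone.
  let P : Set ℝ := {t | ∀ᶠ p in 𝓝 (t, t), (o.lt (e.symm p.1) (e.symm p.2) ↔ p.1 < p.2)}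
  let Q : Set ℝ := {t | ∀ᶠ p in 𝓝 (t, t), (o.lt (e.symm p.1) (e.symm p.2) ↔ p.2 < p.1)}
  change e.target ⊆ P ∨ e.target ⊆ Q
  refine IsPreconnected.subset_or_subset (hopen _) (hopen _) ?_ ?_ ?_
  · rw [Set.disjoint_left]
    intro t h1 h2
    have h3 : Filter.Tendsto (fun s : ℝ => (t, s)) (𝓝[>] t) (𝓝 (t, t)) :=
      ((continuous_const.prodMk continuous_id).tendsto t).mono_left nhdsWithin_le_nhds
    have h4 := (h3.eventually (h1.and h2)).and self_mem_nhdsWithin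
    obtain ⟨s, ⟨h5, h6⟩, h7⟩ := h4.exists
    exact lt_asymm (h6.1 (h5.2 h7)) h7
  · intro t ht
    obtain ⟨U, hU, φ, hφc, hφi, hφ⟩ := o.exists_coord (e.symm t)
    have h1 : e.symm ⁻¹' U ∩ e.target ∈ 𝓝 t :=
      Filter.inter_mem ((e.continuousAt_symm ht).preimage_mem_nhds hU)
        (e.open_target.mem_nhds ht)
    obtain ⟨a, b, hab, hsub⟩ := mem_nhds_iff_exists_Ioo_subset.1 h1
    have hc : ContinuousOn (φ ∘ e.symm) (Set.Ioo a b) :=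
      hφc.comp (e.continuousOn_symm.mono fun s hs => (hsub hs).2) fun s hs => (hsub hs).1
    have hi : Set.InjOn (φ ∘ e.symm) (Set.Ioo a b) :=
      hφi.comp (e.symm.injOn.mono fun s hs => (hsub hs).2) fun s hs => (hsub hs).1
    have hmem : Set.Ioo a b ×ˢ Set.Ioo a b ∈ 𝓝 (t, t) :=
      prod_mem_nhds (isOpen_Ioo.mem_nhds hab) (isOpen_Ioo.mem_nhds hab)
    refine (hc.strictMonoOn_of_injOn_Ioo (hab.1.trans hab.2) hi).imp (fun hm => ?_) fun hm => ?_
    · filter_upwards [hmem] with p hp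
      rw [hφ _ (hsub hp.1).1 _ (hsub hp.2).1]
      exact hm.lt_iff_lt hp.1 hp.2
    · filter_upwards [hmem] with p hp
      rw [hφ _ (hsub hp.1).1 _ (hsub hp.2).1]
      exact hm.lt_iff_gt hp.1 hp.2
  · rw [he]
    exact isPreconnected_Ioo

/-- A point and its image may be far apart in the chart, so the orientation must agree with the same
order of the chart at both; `extendFun h` is increasing for either order. -/
theorem chartHomeo_preservesOrientation [T2Space M] (o : OneOrientation M)
    (he : e.target = Set.Ioo (-2) 2) (h : ℝ ≃o ℝ) : PreservesOrientation o (chartHomeo he h) := by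
  intro m
  change ∀ᶠ p in 𝓝 (m, m), (o.lt p.1 p.2 ↔ o.lt (chartFun e h p.1) (chartFun e h p.2))
  by_cases hm : m ∈ e.source
  · have hmem : e.source ×ˢ e.source ∈ 𝓝 (m, m) :=
      prod_mem_nhds (e.open_source.mem_nhds hm) (e.open_source.mem_nhds hm)
    have hc : Filter.Tendsto (fun p : M × M => (e p.1, e p.2)) (𝓝 (m, m)) (𝓝 (e m, e m)) := by
      rw [nhds_prod_eq, nhds_prod_eq]
      exact (e.continuousAt hm).tendsto.prodMap (e.continuousAt hm).tendsto
    have hc' : Filter.Tendsto (fun p : M × M => (extendFun h (e p.1), extendFun h (e p.2)))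
        (𝓝 (m, m)) (𝓝 (extendFun h (e m), extendFun h (e m))) := by
      have h1 : Filter.Tendsto (fun y => extendFun h (e y)) (𝓝 m) (𝓝 (extendFun h (e m))) :=
        ((extendFun_continuous h).tendsto _).comp (e.continuousAt hm).tendsto
      rw [nhds_prod_eq, nhds_prod_eq]
      exact h1.prodMap h1
    have ht := e.map_source hm
    have ht' := extendFun_mem_target he h hm
    rcases o.chart_lt_iff he with ho | ho
    · filter_upwards [hmem, hc.eventually (ho _ ht), hc'.eventually (ho _ ht')] with p hp h1 h2
      rw [e.left_inv hp.1, e.left_inv hp.2] at h1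
      rw [chartFun_of_mem h hp.1, chartFun_of_mem h hp.2, h1, h2]
      exact (extendFun_strictMono h).lt_iff_lt.symm
    · filter_upwards [hmem, hc.eventually (ho _ ht), hc'.eventually (ho _ ht')] with p hp h1 h2
      rw [e.left_inv hp.1, e.left_inv hp.2] at h1
      rw [chartFun_of_mem h hp.1, chartFun_of_mem h hp.2, h1, h2]
      exact (extendFun_strictMono h).lt_iff_lt.symm
  · have h1 := chartFun_eventually_eq he h hm
    rw [nhds_prod_eq]
    filter_upwards [h1.prod_mk h1] with p hp
    rw [hp.1, hp.2]

theorem exists_injective_hom_HomeoPlus [Nonempty M] (hM : IsOneManifold M) (o : OneOrientation M) :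
    ∃ Φ : (ℝ ≃o ℝ) →* HomeoPlus o, Function.Injective Φ := by
  have := hM.t2
  obtain ⟨e, he⟩ := hM.exists_chart_Ioo
  refine ⟨(chartHomeo he).codRestrict _ (chartHomeo_preservesOrientation o he), ?_⟩
  intro g h hgh
  exact chartHomeo_injective he (congrArg Subtype.val hgh)

end Chart

/-! ## The main theorem -/

/-- A family of types indexed by sets of naturals, whose isomorphism classes are countable, has an
uncountable subfamily of pairwise non-isomorphic members. -/
theorem exists_uncountable_representatives {G : Type*} [Group G] (S : Set ℕ → Subgroup G)
    (hS : ∀ A, {B | Nonempty (S A ≃* S B)}.Countable) :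
    ∃ 𝒮 ⊆ Set.range S, ¬ 𝒮.Countable ∧
      ∀ H ∈ 𝒮, ∀ K ∈ 𝒮, H ≠ K → IsEmpty (H ≃* K) := by
  let r : Setoid (Set ℕ) :=
    { r := fun A B => Nonempty (S A ≃* S B)
      iseqv := ⟨fun _ => ⟨MulEquiv.refl _⟩, fun ⟨f⟩ => ⟨f.symm⟩, fun ⟨f⟩ ⟨g⟩ => ⟨f.trans g⟩⟩ }
  refine ⟨Set.range fun q : Quotient r => S q.out, ?_, ?_, ?_⟩
  · rintro _ ⟨q, rfl⟩
    exact ⟨_, rfl⟩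
  · intro hc
    have h1 : (⋃ H ∈ Set.range fun q : Quotient r => S q.out,
        {B | Nonempty (H ≃* S B)}).Countable := by
      refine hc.biUnion ?_
      rintro _ ⟨q, rfl⟩
      exact hS q.out
    have h2 : (Set.univ : Set (Set ℕ)).Countable := by
      refine h1.mono fun B _ => ?_
      simp only [Set.mem_iUnion]
      exact ⟨_, ⟨Quotient.mk r B, rfl⟩, Quotient.exact (Quotient.out_eq (Quotient.mk r B))⟩
    have := Set.countable_univ_iff.1 h2
    obtain ⟨f, hf⟩ := exists_surjective_nat (Set ℕ)
    exact Function.cantor_surjective f hf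
  · rintro _ ⟨q, rfl⟩ _ ⟨q', rfl⟩ hne
    refine ⟨fun f => hne ?_⟩
    have h1 : q = q' := by
      rw [← Quotient.out_eq q, ← Quotient.out_eq q']
      exact Quotient.sound ⟨f⟩
    rw [h1]

theorem mainTheorem5 (M : Type*) [TopologicalSpace M] [Nonempty M] (hM : IsOneManifold M)
    (o : OneOrientation M) :
    ∃ 𝒮 : Set (Subgroup (HomeoPlus o)),
      ¬ 𝒮.Countable ∧
      (∀ S ∈ 𝒮, ∀ T ∈ 𝒮, S ≠ T → IsEmpty (S ≃* T)) ∧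
      (∀ S ∈ 𝒮, Countable S ∧ IsSimpleGroup S) ∧
      ∀ S ∈ 𝒮, ∃ L : Subgroup (HomeoPlus o), S = ⁅L, L⁆ ∧
        ∃ G : Subgroup (ℝ ≃o ℝ), IsChainGroup 3 G ∧ Nonempty (L ≃* G) := by
  obtain ⟨Φ, hΦ⟩ := exists_injective_hom_HomeoPlus hM o
  let D : Set ℕ → Subgroup (ℝ ≃o ℝ) := fun A => ⁅codedChainGroup A, codedChainGroup A⁆
  let E : ∀ A, D A ≃* (D A).map Φ := fun A => (D A).equivMapOfInjective Φ hΦ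
  obtain ⟨𝒮, hsub, hunc, hiso⟩ := exists_uncountable_representatives (fun A => (D A).map Φ) <| by
    intro A
    have : Countable (D A) := codedChainGroup.countable_commutator A
    -- If D_B ≅ D_A, a triple of D_B with code B transports to a triple of D_A with the same code.
    -- The sets B in question are thus codes of triples from one countable group.
    refine (Set.countable_range
      (codedChainGroup.commutationCode : D A × D A × D A → Set ℕ)).mono ?_
    rintro B ⟨f⟩
    obtain ⟨p, hp⟩ := codedChainGroup.exists_commutationCode_eq B
    let F : D B ≃* D A := (E B).trans (f.symm.trans (E A).symm)
    exact ⟨_, (codedChainGroup.commutationCode_map F.toMonoidHom F.injective p).trans hp⟩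
  refine ⟨𝒮, hunc, hiso, fun S hS => ?_, fun S hS => ?_⟩
  · obtain ⟨A, rfl⟩ := hsub hS
    have : Countable (D A) := codedChainGroup.countable_commutator A
    have : IsSimpleGroup (D A) := codedChainGroup.isSimpleGroup_commutator A
    exact ⟨(E A).symm.injective.countable, (E A).symm.isSimpleGroup⟩
  · obtain ⟨A, rfl⟩ := hsub hS
    exact ⟨(codedChainGroup A).map Φ, Subgroup.map_commutator _ _ _, codedChainGroup A,
      isChainGroup_codedChainGroup A, ⟨((codedChainGroup A).equivMapOfInjective Φ hΦ).symm⟩⟩
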